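/- Let $\Lambda^n$ be the space of homogeneous symmetric functions of degree $n\ge 0$ in infinitely many variables over a field of characteristic $0$, and let $\langle\cdot,\cdot\rangle$ be the Hall inner product, i.e. the bilinear form on $\Lambda^n$ with $\langle m_\lambda,h_\mu\rangle=\delta_{\lambda\mu}$, where $m_\lambda$ and $h_\mu$ are the monomial and the complete homogeneous symmetric functions. For $f\in\Lambda^n$ write $f[a_1,a_2,a_3,\dots]$ for the result of expressing $f$ as a polynomial in the power sums $p_1,p_2,\dots$ and replacing each $p_i$ by $a_i$. For a composition $\alpha$ of $n$ let $B_\alpha$ be the border strip whose rows, from bottom to top, have lengths $\alpha_1,\alpha_2,\dots$ (each row begins in the column in which the row below it ends). Let $\tau_n=B_\alpha$ with $\alpha=(1,2,2,\dots,2,j)$, a composition of $n$, where $j=1$ if $n$ is even and $j=2$ if $n$ is odd (so $\alpha=(1)$ for $n=1$, and $\tau_0$ is the empty shape). Let $\tau_n'$ be the conjugate (transposed) shape, and let $s_{\tau_n}$, $s_{\tau_n'}$ be the corresponding skew Schur functions. Let $E_k$ be the Euler number, i.e. the number of permutations $a_1a_2\cdots a_k$ of $1,2,\dots,k$ with $a_1>a_2<a_3>a_4<\cdots$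 (so $E_0=1$). A polynomial in the indeterminate $E$ is evaluated umbrally: it is first expanded in powers of $E$, and then, as the last step, each $E^k$ (including $E^0=1$) is replaced by the number $E_k$. Theorem. Let $f$ be a homogeneous symmetric function of degree $n$. If $n$ is odd, then $$\langle f,s_{\tau_n}\rangle=\langle f,s_{\tau_n'}\rangle=f[E,0,-E,0,E,0,-E,0,\dots].$$ If $n$ is even, then $$\langle f,s_{\tau_n}\rangle=f[E,-1,-E,1,E,-1,-E,1,\dots],$$ $$\langle f,s_{\tau_n'}\rangle=f[E,1,-E,-1,E,1,-E,-1,\dots].$$ Here all three lists are periodic with period $4$, and the right-hand sides are evaluated umbrally. -/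

import Mathlib

/-! Symmetric functions in the infinitely many variables `x_0, x_1, x_2, …` over a field `K`, as
formal power series. -/

namespace SymFun

/-! ### Homogeneous symmetric functions and their classical bases -/

section Bases

variable {K : Type*} [Field K]

/-- `f` is a homogeneous symmetric function of degree `n`: a formal power series in infinitely many
variables, invariant under all permutations of the variables, all of whose monomials have total
degree `n`. -/
def IsHomogeneousSymmetric (n : ℕ) (f : MvPowerSeries ℕ K) : Prop :=
  (∀ (σ : Equiv.Perm ℕ) (d : ℕ →₀ ℕ),
      MvPowerSeries.coeff (d.mapDomain σ) f = MvPowerSeries.coeff d f) ∧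
    ∀ d : ℕ →₀ ℕ, MvPowerSeries.coeff d f ≠ 0 → d.degree = n

variable (K)

/-- The monomial symmetric function `m_μ`: the sum of all monomials whose multiset of nonzero
exponents is `μ`. -/
noncomputable def monomialSymm {n : ℕ} (μ : n.Partition) : MvPowerSeries ℕ K :=
  fun d : ℕ →₀ ℕ => if d.support.val.map d = μ.parts then 1 else 0

/-- The complete homogeneous symmetric function `h_k`: the sum of all monomials of degree `k`. -/
noncomputable def completeSymm (k : ℕ) : MvPowerSeries ℕ K :=
  fun d : ℕ →₀ ℕ => if d.degree = k then 1 else 0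

open Classical in
/-- The power sum symmetric function `p_k = ∑ᵢ x_i ^ k` (for `1 ≤ k`). -/
noncomputable def powerSum (k : ℕ) : MvPowerSeries ℕ K :=
  fun d : ℕ →₀ ℕ => if ∃ i : ℕ, d = Finsupp.single i k then 1 else 0

/-- `h_μ = h_{μ₁} h_{μ₂} ⋯`. -/
noncomputable def completeSymmPart {n : ℕ} (μ : n.Partition) : MvPowerSeries ℕ K :=
  (μ.parts.map (completeSymm K)).prod

/-- `p_μ = p_{μ₁} p_{μ₂} ⋯`. -/
noncomputable def powerSumPart {n : ℕ} (μ : n.Partition) : MvPowerSeries ℕ K :=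
  (μ.parts.map (powerSum K)).prod

variable {K}

open Classical in
/-- The coefficients of `f` in an expansion `f = ∑_μ c_μ v_μ` over the partitions `μ` of `n`. For a
basis `v` of the space of homogeneous symmetric functions of degree `n` (such as the `m_μ`, the
`h_μ` or, in characteristic `0`, the `p_μ`) and `f` in this space, the expansion exists and is
unique; by convention the value is `0` if there is no expansion. -/
noncomputable def expansion {n : ℕ} (v : n.Partition → MvPowerSeries ℕ K)
    (f : MvPowerSeries ℕ K) : n.Partition → K :=
  if h : ∃ c : n.Partition → K, f = ∑ μ, c μ • v μ then h.choose else 0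

/-- The Hall inner product of two homogeneous symmetric functions of degree `n`, i.e. the bilinear
form with `⟨m_μ, h_ν⟩ = δ_{μν}`. -/
noncomputable def hallInner (n : ℕ) (f g : MvPowerSeries ℕ K) : K :=
  ∑ μ : n.Partition, expansion (monomialSymm K) f μ * expansion (completeSymmPart K) g μ

/-- `f[a_1, a_2, …]`: a homogeneous symmetric function `f` of degree `n` is written as a polynomial
in the power sums, and `p_i` is replaced by `a_i` (`i ≥ 1`), an element of a commutative
`K`-algebra. -/
noncomputable def powerSumSubst {A : Type*} [CommRing A] [Algebra K A] (n : ℕ)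
    (f : MvPowerSeries ℕ K) (a : ℕ → A) : A :=
  ∑ μ : n.Partition, expansion (powerSumPart K) f μ • (μ.parts.map a).prod

end Bases

/-! ### Skew Schur functions and border strips -/

/-- A filling of a diagram `D` by natural numbers (cells are `(row, column)`, rows numbered
downwards) is semistandard if it weakly increases along rows, from left to right, and strictly
increases down columns. -/
def IsSemistandard (D : Finset (ℕ × ℕ)) (T : D → ℕ) : Prop :=
  (∀ c c' : D, c.1.1 = c'.1.1 → c.1.2 < c'.1.2 → T c ≤ T c') ∧
    ∀ c c' : D, c.1.2 = c'.1.2 → c.1.1 < c'.1.1 → T c < T c'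

/-- The (skew) Schur function `s_D = ∑_T ∏_{c ∈ D} x_{T(c)}` of a skew shape, given by its finite
set `D` of cells, where `T` runs over the semistandard fillings of `D`. -/
noncomputable def skewSchur (K : Type*) [Field K] (D : Finset (ℕ × ℕ)) : MvPowerSeries ℕ K :=
  fun d : ℕ →₀ ℕ =>
    (Nat.card {T : D → ℕ // IsSemistandard D T ∧ ∑ c, Finsupp.single (T c) 1 = d} : K)

/-- The border strip `B_α` of a composition `α`: its rows, from bottom to top, have lengths
`α_1, α_2, …`, and each row begins in the column in which the row below it ends. -/
def borderStrip {n : ℕ} (α : Composition n) : Finset (ℕ × ℕ) :=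
  Finset.univ.biUnion fun t : Fin α.length =>
    (Finset.range (α.blocksFun t)).image fun j =>
      (α.length - 1 - (t : ℕ), (α.sizeUpTo t - (t : ℕ)) + j)

/-- The conjugate (transposed) shape. -/
def conjugate (D : Finset (ℕ × ℕ)) : Finset (ℕ × ℕ) := D.image Prod.swap

/-- The composition `(1, 2, 2, …, 2, j)` of `n`, where `j = 1` if `n` is even and `j = 2` if `n` is
odd; it is `(1)` for `n = 1` and empty for `n = 0`. -/
def tauComposition (n : ℕ) : Composition n where
  blocks :=
    if n = 0 then []
    else 1 :: (List.replicate ((n - 1) / 2) 2 ++ if Even n then [1] else [])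
  blocks_pos := by
    intro i hi
    split_ifs at hi <;> simp at hi <;> omega
  blocks_sum := by
    split_ifs with h0 h1
    · simp [h0]
    · obtain ⟨k, rfl⟩ := h1
      simp
      omega
    · obtain ⟨k, rfl⟩ := Nat.not_even_iff_odd.mp h1
      simp
      omega

/-- The alternating border strip `τ_n = B_{(1, 2, …, 2, j)}`. -/
def tau (n : ℕ) : Finset (ℕ × ℕ) := borderStrip (tauComposition n)

/-! ### Euler numbers and umbral evaluation -/

/-- `w = a_1 a_2 ⋯ a_n` is alternating: `a_1 > a_2 < a_3 > a_4 < ⋯` (positions are numbered from `0`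
in the code). -/
def IsAlternatingPerm {n : ℕ} (w : Equiv.Perm (Fin n)) : Prop :=
  ∀ i j : Fin n, (j : ℕ) = i + 1 → if Even (i : ℕ) then w j < w i else w i < w j

/-- The Euler number `E_n`: the number of alternating permutations of `n` letters. -/
noncomputable def eulerNumber (n : ℕ) : ℕ :=
  Nat.card {w : Equiv.Perm (Fin n) // IsAlternatingPerm w}

/-- Umbral evaluation of a polynomial in `E`: each power `E ^ k` is replaced by the Euler number
`E_k`. -/
noncomputable def umbral {K : Type*} [Field K] (P : Polynomial K) : K :=
  P.sum fun k c => c * (eulerNumber k : K)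

/-- The sequence `a, b, c, d, a, b, c, d, …` of period `4`, with terms numbered from `1`. -/
def periodicFour {A : Type*} (a b c d : A) (i : ℕ) : A :=
  match i % 4 with
  | 1 => a
  | 2 => b
  | 3 => c
  | _ => d

end SymFun

/-! The operator `p_k^⊥`, adjoint to multiplication by `p_k`, is a derivation with `h_n ↦ h_{n-k}`
and `e_n ↦ (-1)^(k-1) e_{n-k}`. Applying it for all parts of `μ` and taking the constant term
computes the pairing with `p_μ` (`hallInner_evalH`). By linearity it remains to follow these
operators on the functions of the alternating strips.

Read along the strip, a semistandard filling of `τ_n` is a word `a > b ≤ c > ⋯`, and one of the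
conjugate shape a word `a ≥ b < c ≥ ⋯`. A telescoping count of such words
(`cosSeries_mul_altSeries`) shows that their generating series in `t` is `sec + tan`. Here cosine
and sine are `∑ (-1)^m g_{2m} t^{2m}` and `∑ (-1)^m g_{2m+1} t^{2m+1}`, with `g = e` for `τ_n` and
`g = h` for its conjugate. Even degrees come from the secant, odd degrees from the tangent.

On cosine and sine, `p_k^⊥` acts as `± t^k`, exchanging the two for odd `k`. By the quotient rule,
an even `k` multiplies the secant by `± t^k` and kills the tangent. An odd `k` acts on either as
`(-1)^((k-1)/2) t^(k-1) p_1^⊥` (`isSkewCompatible_sec`, `isSkewCompatible_tan`). These scalars are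
the coefficients in the periodic lists. If `μ` has `r` odd parts, what is left besides the scalars
is `(p_1^⊥)^r` on the term of degree `r`. That is its coefficient of `x_0 ⋯ x_{r-1}`, which counts
alternating permutations (`coeff_altSeries_eq_eulerNumber`), so `E^r` is read as `E_r`. -/

namespace SymFun

/-! ### The derivations `p_k^⊥` on polynomials in the `h_n`. -/

section SkewDerivation

-- A monomial of `p_k` dividing `x^d` is some `x_i^k`. The same recursion holds in
-- `skewD_hMonomial`; together they say that `skewD` is adjoint to multiplication by `p_k`.
open MvPowerSeries in
theorem coeff_powerSum_mul {K : Type*} [Field K] {k : ℕ} (hk : 0 < k) (f : MvPowerSeries ℕ K)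
    (d : ℕ →₀ ℕ) :
    coeff d (powerSum K k * f) =
      ∑ i ∈ d.support with k ≤ d i, coeff (d - Finsupp.single i k) f := by
  classical
  rw [MvPowerSeries.coeff_mul]
  symm
  refine Finset.sum_of_injOn (fun i => (Finsupp.single i k, d - Finsupp.single i k)) ?_ ?_ ?_ ?_
  · intro i _ j _ h
    exact (Finsupp.single_left_inj hk.ne').1 (Prod.ext_iff.1 h).1
  · intro i hi
    simp only [Finset.coe_filter, Set.mem_ofPred_eq] at hi
    simp only [Finset.mem_coe, Finset.HasAntidiagonal.mem_antidiagonal]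
    exact add_tsub_cancel_of_le (Finsupp.single_le_iff.2 hi.2)
  · rintro ⟨a, b⟩ hab hn
    have : ¬ ∃ i, a = Finsupp.single i k := by
      rintro ⟨i, rfl⟩
      apply hn
      rw [Finset.HasAntidiagonal.mem_antidiagonal] at hab
      simp only at hab
      refine ⟨i, ?_, ?_⟩
      · simp only [Finset.coe_filter, Set.mem_ofPred_eq, Finsupp.mem_support_iff, ← hab,
          Finsupp.add_apply, Finsupp.single_eq_same]
        omega
      · simp [← hab]
    have h0 : coeff a (powerSum K k) = 0 := if_neg this
    simp [h0]
  · intro i _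
    have h1 : coeff (Finsupp.single i k) (powerSum K k) = 1 := if_pos ⟨i, rfl⟩
    simp [h1]

variable {K : Type*} [Field K]

variable (K) in
/-- The generator `h_n` of the ring of symmetric functions, viewed as a polynomial ring in
`h_1, h_2, …`. -/
noncomputable def hGen : ℕ → MvPolynomial ℕ K
  | 0 => 1
  | n + 1 => MvPolynomial.X n

variable (K) in
/-- The realisation of polynomials in `h_1, h_2, …` as formal power series. -/
noncomputable def evalH : MvPolynomial ℕ K →ₐ[K] MvPowerSeries ℕ K :=
  MvPolynomial.aeval fun i => completeSymm K (i + 1)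

theorem completeSymm_zero : completeSymm K 0 = 1 := by
  classical
  ext d
  rw [MvPowerSeries.coeff_one]
  show (if d.degree = 0 then (1 : K) else 0) = _
  simp [Finsupp.degree_eq_zero_iff]

theorem coeff_completeSymm (k : ℕ) (d : ℕ →₀ ℕ) :
    MvPowerSeries.coeff d (completeSymm K k) = if d.degree = k then 1 else 0 := rfl

theorem evalH_hGen (n : ℕ) : evalH K (hGen K n) = completeSymm K n := by
  cases n with
  | zero => simp [hGen, completeSymm_zero]
  | succ n => simp [hGen, evalH]

variable (K) in
/-- The derivation `p_k^⊥`, sending `h_n` to `h_{n-k}`. -/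
noncomputable def skewD (k : ℕ) : Derivation K (MvPolynomial ℕ K) (MvPolynomial ℕ K) :=
  MvPolynomial.mkDerivation K fun i => if k ≤ i + 1 then hGen K (i + 1 - k) else 0

theorem skewD_hGen {k : ℕ} (hk : 0 < k) (n : ℕ) :
    skewD K k (hGen K n) = if k ≤ n then hGen K (n - k) else 0 := by
  cases n with
  | zero => simp [hGen, hk.ne']
  | succ n => simp [hGen, skewD, MvPolynomial.mkDerivation_X]

/-- The commutator of two derivations is a derivation, so it suffices that it vanishes on the
generators. -/
theorem skewD_comm {k l : ℕ} (hk : 0 < k) (hl : 0 < l) (G : MvPolynomial ℕ K) :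
    skewD K k (skewD K l G) = skewD K l (skewD K k G) := by
  have : ⁅skewD K k, skewD K l⁆ = 0 := by
    apply MvPolynomial.derivation_ext
    intro i
    have hi : (MvPolynomial.X i : MvPolynomial ℕ K) = hGen K (i + 1) := rfl
    rw [Derivation.commutator_apply, hi, skewD_hGen hk, skewD_hGen hl]
    simp only [Derivation.coe_zero, Pi.zero_apply, sub_eq_zero]
    split_ifs with h1 h2 h2
    · rw [skewD_hGen hk, skewD_hGen hl]
      have : k ≤ i + 1 - l ↔ l ≤ i + 1 - k := by omega
      simp only [this]
      split_ifs
      · congr 1; omega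
      · rfl
    · rw [skewD_hGen hk, if_neg (by omega), map_zero]
    · rw [skewD_hGen hl, if_neg (by omega), map_zero]
    · simp
  have h2 := DFunLike.congr_fun this G
  rwa [Derivation.commutator_apply, Derivation.coe_zero, Pi.zero_apply, sub_eq_zero] at h2

theorem derivation_finset_prod {A : Type*} [CommRing A] [Algebra K A] (D : Derivation K A A)
    {ι : Type*} [DecidableEq ι] (s : Finset ι) (f : ι → A) :
    D (∏ i ∈ s, f i) = ∑ i ∈ s, (∏ j ∈ s.erase i, f j) * D (f i) := by
  induction s using Finset.induction_on with
  | empty => simp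
  | insert a s ha ih =>
    rw [Finset.prod_insert ha, Derivation.leibniz, ih, Finset.sum_insert ha,
      Finset.erase_insert ha, add_comm, smul_eq_mul, smul_eq_mul, Finset.mul_sum]
    congr 1
    refine Finset.sum_congr rfl fun i hi => ?_
    have hia : i ≠ a := fun h => ha (h ▸ hi)
    rw [Finset.erase_insert_of_ne hia.symm, Finset.prod_insert (by simp [ha]), mul_assoc]

variable (K) in
/-- The product `∏ᵢ h_{d i}`. -/
noncomputable def hMonomial (d : ℕ →₀ ℕ) : MvPolynomial ℕ K := d.prod fun _ k => hGen K k

/-- By Leibniz, each summand lowers one factor. Indexing by exponent vectors rather than partitions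
makes the terms match those of `coeff_powerSum_mul`. -/
theorem skewD_hMonomial {k : ℕ} (hk : 0 < k) (d : ℕ →₀ ℕ) :
    skewD K k (hMonomial K d) =
      ∑ i ∈ d.support with k ≤ d i, hMonomial K (d - Finsupp.single i k) := by
  classical
  rw [hMonomial, Finsupp.prod, derivation_finset_prod, Finset.sum_filter]
  refine Finset.sum_congr rfl fun i hi => ?_
  rw [skewD_hGen hk]
  split_ifs with h
  · rw [hMonomial, Finsupp.prod_of_support_subset (s := d.support) _ _ _ (fun _ _ => rfl),
      ← Finset.mul_prod_erase _ _ hi, mul_comm]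
    · congr 1
      · simp
      · refine Finset.prod_congr rfl fun j hj => ?_
        rw [Finset.mem_erase] at hj
        simp [Finsupp.single_eq_of_ne hj.1]
    · intro j
      simp only [Finsupp.mem_support_iff, Finsupp.tsub_apply]
      omega
  · simp

theorem constantCoeff_hMonomial (d : ℕ →₀ ℕ) :
    MvPolynomial.constantCoeff (hMonomial K d) = if d = 0 then 1 else 0 := by
  split_ifs with h
  · simp [h, hMonomial]
  · obtain ⟨i, hi⟩ := Finsupp.support_nonempty_iff.2 h
    rw [hMonomial, Finsupp.prod, map_prod]
    apply Finset.prod_eq_zero hi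
    rw [Finsupp.mem_support_iff] at hi
    obtain ⟨m, hm⟩ := Nat.exists_eq_succ_of_ne_zero hi
    simp [hm, hGen]

/-- The composite of the operators `p_k^⊥` for `k` in a list. -/
noncomputable def skewDList (l : List ℕ) (G : MvPolynomial ℕ K) : MvPolynomial ℕ K :=
  l.foldl (fun G k => skewD K k G) G

theorem skewDList_sum {ι : Type*} (l : List ℕ) (s : Finset ι) (G : ι → MvPolynomial ℕ K) :
    skewDList l (∑ i ∈ s, G i) = ∑ i ∈ s, skewDList l (G i) := by
  induction l generalizing G with
  | nil => rfl
  | cons k l ih => simpa [skewDList, map_sum] using ih _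

theorem skewDList_smul (l : List ℕ) (c : K) (G : MvPolynomial ℕ K) :
    skewDList l (c • G) = c • skewDList l G := by
  induction l generalizing G with
  | nil => rfl
  | cons k l ih => simpa [skewDList] using ih _

theorem coeff_powerSum_prod {l : List ℕ} (hl : ∀ k ∈ l, 0 < k) (d : ℕ →₀ ℕ) :
    MvPowerSeries.coeff d (l.map (powerSum K)).prod =
      MvPolynomial.constantCoeff (skewDList l (hMonomial K d)) := by
  classical
  induction l generalizing d with
  | nil => simp [skewDList, constantCoeff_hMonomial, MvPowerSeries.coeff_one]
  | cons k l ih =>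
    have hk : 0 < k := hl k (by simp)
    rw [List.map_cons, List.prod_cons, coeff_powerSum_mul hk]
    have : skewDList (k :: l) (hMonomial K d) = skewDList l (skewD K k (hMonomial K d)) := rfl
    rw [this, skewD_hMonomial hk, skewDList_sum, map_sum]
    exact Finset.sum_congr rfl fun i _ => ih (fun k hk => hl k (by simp [hk])) _

/-- The coefficients of a product with an index `i` absent from `d`. -/
theorem coeff_add_single_mul (f g : MvPowerSeries ℕ K) {d : ℕ →₀ ℕ} {i : ℕ} (hi : d i = 0) :
    MvPowerSeries.coeff (d + Finsupp.single i 1) (f * g) =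
      ∑ p ∈ Finset.HasAntidiagonal.antidiagonal d,
        (MvPowerSeries.coeff (p.1 + Finsupp.single i 1) f * MvPowerSeries.coeff p.2 g +
          MvPowerSeries.coeff p.1 f * MvPowerSeries.coeff (p.2 + Finsupp.single i 1) g) := by
  classical
  rw [MvPowerSeries.coeff_mul, Finset.sum_add_distrib,
    ← Finset.sum_filter_add_sum_filter_not _ (fun p => p.1 i = 1)]
  congr 1
  · symm
    refine Finset.sum_nbij' (fun p => (p.1 + Finsupp.single i 1, p.2))
      (fun p => (p.1 - Finsupp.single i 1, p.2)) ?_ ?_ ?_ ?_ ?_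
    · rintro ⟨a, b⟩ h
      rw [Finset.HasAntidiagonal.mem_antidiagonal] at h
      have := DFunLike.congr_fun h i
      simp only [Finsupp.add_apply, hi] at this
      simp only [Finset.mem_filter, Finset.HasAntidiagonal.mem_antidiagonal, Finsupp.add_apply,
        Finsupp.single_eq_same]
      refine ⟨?_, by omega⟩
      rw [← h]; simp only; abel
    · rintro ⟨a, b⟩ h
      simp only [Finset.mem_filter, Finset.HasAntidiagonal.mem_antidiagonal] at h ⊢
      ext j
      have := DFunLike.congr_fun h.1 j
      by_cases hj : j = i
      · subst hj
        simp at this ⊢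
        omega
      · simpa [Finsupp.single_eq_of_ne hj] using this
    · rintro ⟨a, b⟩ h
      simp
    · rintro ⟨a, b⟩ h
      simp only [Finset.mem_filter] at h
      simp only [Prod.mk.injEq, and_true]
      exact tsub_add_cancel_of_le (Finsupp.single_le_iff.2 h.2.ge)
    · rintro ⟨a, b⟩ h
      rfl
  · symm
    refine Finset.sum_nbij' (fun p => (p.1, p.2 + Finsupp.single i 1))
      (fun p => (p.1, p.2 - Finsupp.single i 1)) ?_ ?_ ?_ ?_ ?_
    · rintro ⟨a, b⟩ h
      rw [Finset.HasAntidiagonal.mem_antidiagonal] at h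
      have := DFunLike.congr_fun h i
      simp only [Finsupp.add_apply, hi] at this
      simp only [Finset.mem_filter, Finset.HasAntidiagonal.mem_antidiagonal]
      refine ⟨?_, by omega⟩
      rw [← h]; simp only; abel
    · rintro ⟨a, b⟩ h
      simp only [Finset.mem_filter, Finset.HasAntidiagonal.mem_antidiagonal] at h ⊢
      have h2 := DFunLike.congr_fun h.1 i
      simp [hi] at h2
      ext j
      have := DFunLike.congr_fun h.1 j
      by_cases hj : j = i
      · subst hj
        simp at this ⊢
        omega
      · simpa [Finsupp.single_eq_of_ne hj] using this
    · rintro ⟨a, b⟩ h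
      simp
    · rintro ⟨a, b⟩ h
      simp only [Finset.mem_filter, Finset.HasAntidiagonal.mem_antidiagonal] at h
      have h2 := DFunLike.congr_fun h.1 i
      simp [hi] at h2
      simp only [Prod.mk.injEq, true_and]
      exact tsub_add_cancel_of_le (Finsupp.single_le_iff.2 (by omega))
    · rintro ⟨a, b⟩ h
      rfl

/-- Extracting the part linear in a variable absent from `d` obeys the product rule and sends `h_n`
to `h_{n-1}`, just as the derivation `p_1^⊥` does. -/
theorem coeff_add_single_evalH (G : MvPolynomial ℕ K) {d : ℕ →₀ ℕ} {i : ℕ} (hi : d i = 0) :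
    MvPowerSeries.coeff (d + Finsupp.single i 1) (evalH K G) =
      MvPowerSeries.coeff d (evalH K (skewD K 1 G)) := by
  classical
  induction G using MvPolynomial.induction_on generalizing d with
  | C a =>
    rw [MvPolynomial.derivation_C, map_zero, map_zero, ← MvPolynomial.algebraMap_eq,
      AlgHom.commutes, MvPowerSeries.algebraMap_apply, MvPowerSeries.coeff_C, if_neg]
    intro h
    simpa using DFunLike.congr_fun h i
  | add p q hp hq => simp only [map_add, hp hi, hq hi]
  | mul_X p j hp =>
    have hgen : ∀ e : ℕ →₀ ℕ, MvPowerSeries.coeff (e + Finsupp.single i 1)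
        (evalH K (MvPolynomial.X j)) = MvPowerSeries.coeff e
          (evalH K (skewD K 1 (MvPolynomial.X j))) := by
      intro e
      have hj : (MvPolynomial.X j : MvPolynomial ℕ K) = hGen K (j + 1) := rfl
      rw [hj, skewD_hGen one_pos, if_pos (by omega), evalH_hGen, evalH_hGen, coeff_completeSymm,
        coeff_completeSymm]
      simp
    rw [map_mul, coeff_add_single_mul _ _ hi, Derivation.leibniz, map_add, smul_eq_mul,
      smul_eq_mul, map_mul, map_mul, mul_comm (evalH K (MvPolynomial.X j)), map_add,
      MvPowerSeries.coeff_mul, MvPowerSeries.coeff_mul, ← Finset.sum_add_distrib]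
    refine Finset.sum_congr rfl fun p hp' => ?_
    rw [Finset.HasAntidiagonal.mem_antidiagonal] at hp'
    have := DFunLike.congr_fun hp' i
    simp only [Finsupp.add_apply, hi] at this
    rw [hp (by omega), hgen, add_comm]

theorem coeff_zero_evalH (G : MvPolynomial ℕ K) :
    MvPowerSeries.coeff 0 (evalH K G) = MvPolynomial.constantCoeff G := by
  induction G using MvPolynomial.induction_on with
  | C a =>
    rw [← MvPolynomial.algebraMap_eq, AlgHom.commutes]
    simp [MvPowerSeries.algebraMap_apply]
  | add p q hp hq => simp only [map_add, hp, hq]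
  | mul_X p j hp =>
    have hj : (MvPolynomial.X j : MvPolynomial ℕ K) = hGen K (j + 1) := rfl
    rw [map_mul, hj, evalH_hGen, MvPowerSeries.coeff_zero_eq_constantCoeff, map_mul,
      ← MvPowerSeries.coeff_zero_eq_constantCoeff_apply (completeSymm K (j + 1)),
      coeff_completeSymm]
    simp [hGen]

/-- Each `p_1^⊥` strips off one fresh variable. This turns the powers of `p_1^⊥` left at the end of
the computation into a squarefree coefficient. -/
theorem coeff_evalH_eq_iterate (r : ℕ) (G : MvPolynomial ℕ K) :
    MvPowerSeries.coeff (∑ i ∈ Finset.range r, Finsupp.single i 1) (evalH K G) =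
      MvPolynomial.constantCoeff ((skewD K 1)^[r] G) := by
  induction r generalizing G with
  | zero => simpa using coeff_zero_evalH G
  | succ r ih =>
    rw [Finset.sum_range_succ, coeff_add_single_evalH, ih, Function.iterate_succ_apply]
    rw [Finsupp.finsetSum_apply]
    refine Finset.sum_eq_zero fun i hi => ?_
    rw [Finsupp.single_eq_of_ne]
    rintro rfl
    simp at hi

end SkewDerivation

end SymFun

namespace SymFun

/-! ### Expansions in monomial symmetric functions and in power sums. -/

section HallPairing

open MvPowerSeries (coeff)

variable {K : Type*} [Field K]

/-- An exponent vector whose nonzero entries are the parts of `μ`. -/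
noncomputable def partExp {n : ℕ} (μ : n.Partition) : ℕ →₀ ℕ := μ.parts.toList.toFinsupp

theorem map_partExp {n : ℕ} (μ : n.Partition) :
    (partExp μ).support.val.map (partExp μ) = μ.parts := by
  have hsupp : (partExp μ).support = Finset.range μ.parts.toList.length := by
    rw [partExp, List.toFinsupp_support, Finset.filter_eq_self]
    intro i hi
    rw [Finset.mem_range] at hi
    rw [List.getD_eq_getElem _ _ hi]
    have := μ.parts_pos (Multiset.mem_toList.1 (List.getElem_mem hi))
    omega
  rw [hsupp, Finset.range_val, Multiset.range, Multiset.map_coe]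
  conv_rhs => rw [← Multiset.coe_toList μ.parts]
  congr 1
  refine List.ext_getElem (by simp) fun i h1 h2 => ?_
  simp only [List.getElem_map, List.getElem_range, partExp, List.toFinsupp_apply]
  exact List.getD_eq_getElem _ _ h2

theorem sum_map_support (d : ℕ →₀ ℕ) : (d.support.val.map d).sum = d.degree := rfl

/-- The partition formed by the nonzero entries of an exponent vector. -/
def expPartition (d : ℕ →₀ ℕ) : d.degree.Partition where
  parts := d.support.val.map d
  parts_pos := by
    intro i hi
    obtain ⟨j, hj, rfl⟩ := Multiset.mem_map.1 hi
    exact Nat.pos_of_ne_zero (Finsupp.mem_support_iff.1 hj)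
  parts_sum := sum_map_support d

theorem exists_partition (d : ℕ →₀ ℕ) {n : ℕ} (h : d.degree = n) :
    ∃ μ : n.Partition, d.support.val.map d = μ.parts := by
  subst h
  exact ⟨expPartition d, rfl⟩

theorem partition_ext {n : ℕ} {μ ν : n.Partition} (h : μ.parts = ν.parts) : μ = ν :=
  Nat.Partition.ext h

theorem coeff_monomialSymm {n : ℕ} (μ : n.Partition) (d : ℕ →₀ ℕ) :
    coeff d (monomialSymm K μ) = if d.support.val.map d = μ.parts then 1 else 0 := rfl

theorem coeff_sum_smul {n : ℕ} (c : n.Partition → K) (v : n.Partition → MvPowerSeries ℕ K)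
    (d : ℕ →₀ ℕ) : coeff d (∑ μ, c μ • v μ) = ∑ μ, c μ * coeff d (v μ) := by
  simp [map_sum]

theorem coeff_sum_monomialSymm {n : ℕ} (c : n.Partition → K) (ν : n.Partition) :
    coeff (partExp ν) (∑ μ, c μ • monomialSymm K μ) = c ν := by
  rw [coeff_sum_smul, Finset.sum_eq_single ν]
  · simp [coeff_monomialSymm, map_partExp]
  · intro μ _ hμ
    rw [coeff_monomialSymm, map_partExp, if_neg, mul_zero]
    exact fun h => hμ (partition_ext h.symm)
  · simp

/-- Exponent vectors with the same multiset of nonzero entries differ by a permutation. -/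
theorem exists_perm_mapDomain {d e : ℕ →₀ ℕ} (h : d.support.val.map d = e.support.val.map e) :
    ∃ σ : Equiv.Perm ℕ, d.mapDomain σ = e := by
  classical
  obtain ⟨x, hx⟩ : ∃ x : List ℕ, (x : Multiset ℕ) = d.support.val := ⟨_, Multiset.coe_toList _⟩
  have hmap : ((x.map d : List ℕ) : Multiset ℕ) = e.support.val.map e := by
    rw [← h, ← hx, Multiset.map_coe]
  obtain ⟨y, hy, hxy⟩ : ∃ y : List ℕ, (y : Multiset ℕ) = e.support.val ∧
      List.Forall₂ (fun a b => d a = e b) x y := by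
    obtain ⟨z, hz⟩ : ∃ z : List ℕ, (z : Multiset ℕ) = e.support.val := ⟨_, Multiset.coe_toList _⟩
    have hp : (x.map d).Perm (z.map e) := by
      rw [← Multiset.coe_eq_coe, hmap, ← hz, Multiset.map_coe]
    have hz2 : List.Forall₂ (fun a b => a = e b) (z.map e) z := by
      rw [List.forall₂_map_left_iff, List.forall₂_same]
      simp
    obtain ⟨y, h1, h2⟩ := List.perm_comp_forall₂ hp hz2
    refine ⟨y, ?_, ?_⟩
    · rw [← hz, Multiset.coe_eq_coe]
      exact h2
    · rwa [List.forall₂_map_left_iff] at h1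
  have hxnd : x.Nodup := by rw [← Multiset.coe_nodup, hx]; exact d.support.nodup
  have hynd : y.Nodup := by rw [← Multiset.coe_nodup, hy]; exact e.support.nodup
  have hlen := hxy.length_eq
  -- Some permutation of `ℕ` carries the distinct entries of `x` to those of `y`, the two supports
  -- listed in matching order.
  have := Equiv.Perm.isMultiplyPretransitive ℕ x.length
  obtain ⟨σ, hσ⟩ := MulAction.exists_smul_eq (Equiv.Perm ℕ)
    (⟨fun i : Fin x.length => x[i], fun i j hij => Fin.ext ((hxnd.getElem_inj_iff).1 hij)⟩ :
      Fin x.length ↪ ℕ)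
    ⟨fun i : Fin x.length => y[(i : ℕ)]'(hlen ▸ i.2),
      fun i j hij => Fin.ext ((hynd.getElem_inj_iff).1 hij)⟩
  have hσ' : ∀ (i : ℕ) (h1 : i < x.length) (h2 : i < y.length), σ x[i] = y[i] := fun i h1 h2 =>
    DFunLike.congr_fun hσ (⟨i, h1⟩ : Fin x.length)
  refine ⟨σ, ?_⟩
  ext b
  obtain ⟨a, rfl⟩ := σ.surjective b
  rw [Finsupp.mapDomain_apply σ.injective]
  have hmx : ∀ a, a ∈ x ↔ d a ≠ 0 := fun a => by
    rw [← Multiset.mem_coe, hx, Finset.mem_val, Finsupp.mem_support_iff]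
  have hmy : ∀ a, a ∈ y ↔ e a ≠ 0 := fun a => by
    rw [← Multiset.mem_coe, hy, Finset.mem_val, Finsupp.mem_support_iff]
  by_cases ha : a ∈ x
  · obtain ⟨i, hi, rfl⟩ := List.getElem_of_mem ha
    rw [hσ' i hi (hlen ▸ hi)]
    exact hxy.get hi (hlen ▸ hi)
  · rw [not_not.1 ((hmx a).not.1 ha)]
    by_contra hne
    obtain ⟨i, hi, hi2⟩ := List.getElem_of_mem ((hmy _).2 (Ne.symm hne))
    rw [← hσ' i (hlen ▸ hi) hi] at hi2
    exact ha (σ.injective hi2 ▸ List.getElem_mem _)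

/-- Symmetric series are combinations of monomial symmetric functions. -/
theorem eq_sum_monomialSymm {n : ℕ} {f : MvPowerSeries ℕ K}
    (hsymm : ∀ d e : ℕ →₀ ℕ, d.support.val.map d = e.support.val.map e → coeff d f = coeff e f)
    (hdeg : ∀ d : ℕ →₀ ℕ, coeff d f ≠ 0 → d.degree = n) :
    f = ∑ μ : n.Partition, coeff (partExp μ) f • monomialSymm K μ := by
  ext d
  rw [coeff_sum_smul]
  by_cases hd : d.degree = n
  · obtain ⟨μ, hμ⟩ := exists_partition d hd
    rw [Finset.sum_eq_single μ]
    · rw [coeff_monomialSymm, if_pos hμ, mul_one]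
      exact hsymm _ _ (hμ.trans (map_partExp μ).symm)
    · intro ν _ hν
      rw [coeff_monomialSymm, if_neg, mul_zero]
      exact fun h => hν (partition_ext (h.symm.trans hμ))
    · simp
  · rw [Finset.sum_eq_zero]
    · by_contra h
      exact hd (hdeg d h)
    · intro ν _
      rw [coeff_monomialSymm, if_neg, mul_zero]
      intro h
      apply hd
      rw [← sum_map_support, h, ν.parts_sum]

theorem expansion_spec {n : ℕ} {v : n.Partition → MvPowerSeries ℕ K} {f : MvPowerSeries ℕ K}
    (h : ∃ c : n.Partition → K, f = ∑ μ, c μ • v μ) : f = ∑ μ, expansion v f μ • v μ := by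
  rw [expansion, dif_pos h]
  exact h.choose_spec

theorem expansion_monomialSymm {n : ℕ} {f : MvPowerSeries ℕ K}
    (h : ∃ c : n.Partition → K, f = ∑ μ, c μ • monomialSymm K μ) (μ : n.Partition) :
    expansion (monomialSymm K) f μ = coeff (partExp μ) f := by
  conv_rhs => rw [expansion_spec h]
  rw [coeff_sum_monomialSymm]

theorem hMonomial_partExp {n : ℕ} (μ : n.Partition) :
    hMonomial K (partExp μ) = (μ.parts.map (hGen K)).prod := by
  rw [← map_partExp μ, Multiset.map_map]
  rfl

theorem hMonomial_congr {d e : ℕ →₀ ℕ} (h : d.support.val.map d = e.support.val.map e) :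
    hMonomial K d = hMonomial K e := by
  have (d : ℕ →₀ ℕ) : hMonomial K d = ((d.support.val.map d).map (hGen K)).prod := by
    rw [Multiset.map_map]
    rfl
  rw [this, this, h]

theorem coeff_powerSumPart {n : ℕ} (μ : n.Partition) (d : ℕ →₀ ℕ) :
    coeff d (powerSumPart K μ) =
      MvPolynomial.constantCoeff (skewDList μ.parts.toList (hMonomial K d)) := by
  rw [← coeff_powerSum_prod (fun k hk => μ.parts_pos (Multiset.mem_toList.1 hk)), powerSumPart,
    ← Multiset.prod_coe, ← Multiset.map_coe, Multiset.coe_toList]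

/-- The number of ways to write `x ^ d` as a product of `k`-th powers of variables, `k ∈ l`. -/
noncomputable def powerCount : List ℕ → (ℕ →₀ ℕ) → ℕ
  | [], d => if d = 0 then 1 else 0
  | k :: l, d => ∑ i ∈ d.support with k ≤ d i, powerCount l (d - Finsupp.single i k)

theorem coeff_powerSum_prod_eq_powerCount {l : List ℕ} (hl : ∀ k ∈ l, 0 < k) (d : ℕ →₀ ℕ) :
    coeff d (l.map (powerSum K)).prod = (powerCount l d : K) := by
  classical
  induction l generalizing d with
  | nil => simp [powerCount, MvPowerSeries.coeff_one]
  | cons k l ih =>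
    rw [List.map_cons, List.prod_cons, coeff_powerSum_mul (hl k (by simp)), powerCount,
      Nat.cast_sum]
    exact Finset.sum_congr rfl fun i _ => ih (fun k hk => hl k (by simp [hk])) _

theorem support_sub_single {d : ℕ →₀ ℕ} {i k : ℕ} (hi : i ∈ d.support) :
    d.support.val.map d =
      if k = d i then k ::ₘ (d - Finsupp.single i k).support.val.map (d - Finsupp.single i k)
      else d i ::ₘ ((d - Finsupp.single i k).support.erase i).val.map
        (d - Finsupp.single i k) := by
  classical
  have key : d.support.val.map d = d i ::ₘ (d.support.erase i).val.map d := by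
    conv_lhs => rw [← Finset.insert_erase hi]
    rw [Finset.insert_val_of_notMem (by simp), Multiset.map_cons]
  have h2 : (d.support.erase i) = (d - Finsupp.single i k).support.erase i := by
    ext j
    simp only [Finset.mem_erase, Finsupp.mem_support_iff, Finsupp.tsub_apply]
    refine and_congr_right fun hj => ?_
    rw [Finsupp.single_eq_of_ne hj, tsub_zero]
  have h3 : (d.support.erase i).val.map d =
      (d.support.erase i).val.map (d - Finsupp.single i k) := by
    refine Multiset.map_congr rfl fun j hj => ?_
    have : j ≠ i := Finset.ne_of_mem_erase hj
    simp [Finsupp.single_eq_of_ne this]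
  split_ifs with h
  · rw [key, h3, h2, Finset.erase_eq_of_notMem (by simp [h]), ← h]
  · rw [key, h3, h2]

/-- Each factor of the product contributes one variable. If as many variables occur as there are
factors, none is used twice and the exponents are the list itself. -/
theorem card_support_le_of_powerCount {l : List ℕ} {d : ℕ →₀ ℕ} (h : powerCount l d ≠ 0) :
    d.support.card ≤ l.length ∧ (d.support.card = l.length → d.support.val.map d = l) := by
  induction l generalizing d with
  | nil =>
    have : d = 0 := by
      by_contra hd
      exact h (if_neg hd)
    simp [this]
  | cons k l ih =>
    rw [powerCount] at h
    obtain ⟨i, hi, hne⟩ := Finset.exists_ne_zero_of_sum_ne_zero h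
    rw [Finset.mem_filter] at hi
    obtain ⟨ih1, ih2⟩ := ih hne
    have key := support_sub_single (k := k) hi.1
    have hcard := congrArg Multiset.card key
    rw [Multiset.card_map, Finset.card_val] at hcard
    split_ifs at key hcard with hk
    · rw [Multiset.card_cons, Multiset.card_map, Finset.card_val] at hcard
      refine ⟨by simp; omega, fun h2 => ?_⟩
      rw [key, ih2 (by simp at h2; omega), Multiset.cons_coe]
    · have hi' : i ∈ (d - Finsupp.single i k).support := by
        simp
        omega
      rw [Multiset.card_cons, Multiset.card_map, Finset.card_val,
        Finset.card_erase_of_mem hi'] at hcard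
      have := Finset.card_pos.2 ⟨i, hi'⟩
      simp
      omega

theorem powerCount_ne_zero {l : List ℕ} (hl : ∀ k ∈ l, 0 < k) {d : ℕ →₀ ℕ}
    (h : d.support.val.map d = l) : powerCount l d ≠ 0 := by
  induction l generalizing d with
  | nil =>
    have : d = 0 := by simpa using h
    simp [powerCount, this]
  | cons k l ih =>
    have hk : k ∈ d.support.val.map d := by simp [h]
    obtain ⟨i, hi, hik⟩ := Multiset.mem_map.1 hk
    have hi : i ∈ d.support := hi
    have key := support_sub_single (k := k) hi
    rw [if_pos hik.symm, h, ← Multiset.cons_coe, Multiset.cons_inj_right] at key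
    have := ih (fun k hk => hl k (by simp [hk])) key.symm
    rw [powerCount]
    intro h0
    rw [Finset.sum_eq_zero_iff] at h0
    exact this (h0 i (Finset.mem_filter.2 ⟨hi, hik.ge⟩))

theorem degree_of_powerCount_ne_zero {l : List ℕ} {d : ℕ →₀ ℕ} (h : powerCount l d ≠ 0) :
    d.degree = l.sum := by
  induction l generalizing d with
  | nil =>
    have : d = 0 := by
      by_contra hd
      exact h (if_neg hd)
    simp [this]
  | cons k l ih =>
    rw [powerCount] at h
    obtain ⟨i, hi, hne⟩ := Finset.exists_ne_zero_of_sum_ne_zero h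
    rw [Finset.mem_filter] at hi
    have h1 := ih hne
    have h2 : d = d - Finsupp.single i k + Finsupp.single i k :=
      (tsub_add_cancel_of_le (Finsupp.single_le_iff.2 hi.2)).symm
    rw [h2, map_add, h1, Finsupp.degree_single, List.sum_cons, add_comm]

theorem coeff_powerSumPart_eq_powerCount {n : ℕ} (μ : n.Partition) (d : ℕ →₀ ℕ) :
    coeff d (powerSumPart K μ) = (powerCount μ.parts.toList d : K) := by
  rw [← coeff_powerSum_prod_eq_powerCount
    (fun k hk => μ.parts_pos (Multiset.mem_toList.1 hk)), powerSumPart,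
    ← Multiset.prod_coe, ← Multiset.map_coe, Multiset.coe_toList]

variable (K) in
/-- The transition matrix from power sums to monomial symmetric functions. -/
noncomputable def powerMatrix (n : ℕ) : Matrix n.Partition n.Partition K :=
  fun μ ν => coeff (partExp ν) (powerSumPart K μ)

theorem card_support_partExp {n : ℕ} (μ : n.Partition) :
    (partExp μ).support.card = μ.parts.card := by
  rw [← map_partExp, Multiset.card_map, Finset.card_val]

/-- Triangularity by number of parts: in a vanishing combination choose `μ` with nonzero coefficient
and the most parts; the coefficient at `partExp μ` then sees only `p_μ`. The diagonal entry is a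
nonzero natural number, whence characteristic zero. -/
theorem isUnit_powerMatrix [CharZero K] (n : ℕ) : IsUnit (powerMatrix K n) := by
  classical
  rw [← Matrix.vecMul_injective_iff_isUnit]
  rw [← Matrix.coe_vecMulLinear, ← LinearMap.ker_eq_bot, LinearMap.ker_eq_bot']
  intro c hc
  rw [Matrix.vecMulLinear_apply] at hc
  by_contra hne
  obtain ⟨μ₀, hμ₀⟩ := Function.ne_iff.1 hne
  obtain ⟨μ, hμ, hmax⟩ := Finset.exists_max_image (Finset.univ.filter fun μ => c μ ≠ 0)
    (fun μ => μ.parts.card) ⟨μ₀, by simpa using hμ₀⟩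
  have hμ' : c μ ≠ 0 := by simpa using hμ
  have h := congrFun hc μ
  rw [Matrix.vecMul, dotProduct, Finset.sum_eq_single μ] at h
  · refine mul_ne_zero hμ' ?_ h
    rw [powerMatrix, coeff_powerSumPart_eq_powerCount, Nat.cast_ne_zero]
    apply powerCount_ne_zero (fun k hk => μ.parts_pos (Multiset.mem_toList.1 hk))
    rw [map_partExp, Multiset.coe_toList]
  · intro ν _ hν
    by_contra hne
    have hcν : c ν ≠ 0 := left_ne_zero_of_mul hne
    have h2 := right_ne_zero_of_mul hne
    rw [powerMatrix, coeff_powerSumPart_eq_powerCount, Nat.cast_ne_zero] at h2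
    obtain ⟨h3, h4⟩ := card_support_le_of_powerCount h2
    rw [card_support_partExp, Multiset.length_toList] at h3 h4
    have h5 := h4 (le_antisymm h3 (hmax ν (by simpa using hcν)))
    rw [map_partExp, Multiset.coe_toList] at h5
    exact hν (partition_ext h5.symm)
  · simp

theorem powerSumPart_eq_sum {n : ℕ} (μ : n.Partition) :
    powerSumPart K μ = ∑ ν, powerMatrix K n μ ν • monomialSymm K ν := by
  apply eq_sum_monomialSymm
  · intro d e h
    rw [coeff_powerSumPart, coeff_powerSumPart, hMonomial_congr h]
  · intro d h
    rw [coeff_powerSumPart_eq_powerCount] at h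
    replace h : powerCount μ.parts.toList d ≠ 0 := fun h0 => h (by simp [h0])
    rw [degree_of_powerCount_ne_zero h, Multiset.sum_toList, μ.parts_sum]

theorem sum_smul_sum_smul {n : ℕ} (c : n.Partition → K) (A : Matrix n.Partition n.Partition K)
    (v : n.Partition → MvPowerSeries ℕ K) :
    ∑ μ, c μ • ∑ ν, A μ ν • v ν = ∑ ν, (Matrix.vecMul c A) ν • v ν := by
  simp only [Finset.smul_sum, smul_smul]
  rw [Finset.sum_comm]
  refine Finset.sum_congr rfl fun ν _ => ?_
  rw [← Finset.sum_smul]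
  rfl

theorem eq_sum_monomialSymm_of_isHomogeneousSymmetric {n : ℕ} {f : MvPowerSeries ℕ K}
    (hf : IsHomogeneousSymmetric n f) :
    f = ∑ μ : n.Partition, coeff (partExp μ) f • monomialSymm K μ := by
  refine eq_sum_monomialSymm (fun d e h => ?_) hf.2
  obtain ⟨σ, rfl⟩ := exists_perm_mapDomain h
  rw [hf.1]

theorem exists_powerSum_expansion [CharZero K] {n : ℕ} {f : MvPowerSeries ℕ K}
    (hf : IsHomogeneousSymmetric n f) :
    ∃ c : n.Partition → K, f = ∑ μ, c μ • powerSumPart K μ := by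
  classical
  obtain ⟨c, hc⟩ := (Matrix.vecMul_surjective_iff_isUnit.2 (isUnit_powerMatrix (K := K) n))
    fun μ => coeff (partExp μ) f
  refine ⟨c, ?_⟩
  simp only [powerSumPart_eq_sum]
  rw [sum_smul_sum_smul]
  simp only at hc
  rw [hc]
  exact eq_sum_monomialSymm_of_isHomogeneousSymmetric hf

end HallPairing

end SymFun

namespace SymFun

/-! ### The basis `h_μ`, and the Hall pairing computed by skewing. -/

section CompleteBasis

open MvPowerSeries (coeff)

variable {K : Type*} [Field K]

variable (K) in
/-- The span of the products `h_{k_1} h_{k_2} ⋯` with `k_1 + k_2 + ⋯ = n`. -/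
noncomputable def hSpan (n : ℕ) : Submodule K (MvPolynomial ℕ K) :=
  Submodule.span K {G | ∃ s : Multiset ℕ, s.sum = n ∧ (s.map (hGen K)).prod = G}

theorem hGen_mem_hSpan (n : ℕ) : hGen K n ∈ hSpan K n :=
  Submodule.subset_span ⟨{n}, by simp, by simp⟩

theorem one_mem_hSpan : (1 : MvPolynomial ℕ K) ∈ hSpan K 0 :=
  Submodule.subset_span ⟨0, by simp, by simp⟩

theorem mul_mem_hSpan {a b : ℕ} {F G : MvPolynomial ℕ K} (hF : F ∈ hSpan K a)
    (hG : G ∈ hSpan K b) : F * G ∈ hSpan K (a + b) := by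
  have h := Submodule.mul_mem_mul hF hG
  rw [hSpan, hSpan, Submodule.span_mul_span] at h
  refine Submodule.span_mono ?_ h
  rintro _ ⟨_, ⟨s, hs, rfl⟩, _, ⟨t, ht, rfl⟩, rfl⟩
  exact ⟨s + t, by simp [hs, ht], by simp⟩

theorem prod_map_hGen_filter (s : Multiset ℕ) :
    ((s.filter (· ≠ 0)).map (hGen K)).prod = (s.map (hGen K)).prod := by
  induction s using Multiset.induction_on with
  | empty => simp
  | cons a s ih =>
    by_cases ha : a = 0
    · simp only [Multiset.filter_cons, ha, ne_eq, not_true_eq_false, if_false, zero_add,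
        Multiset.map_cons, Multiset.prod_cons, hGen, one_mul]
      exact ih
    · rw [Multiset.filter_cons_of_pos (p := (· ≠ 0)) _ ha, Multiset.map_cons, Multiset.prod_cons, ih,
        Multiset.map_cons, Multiset.prod_cons]

theorem exists_eq_sum_of_mem_hSpan {n : ℕ} {G : MvPolynomial ℕ K} (hG : G ∈ hSpan K n) :
    ∃ c : n.Partition → K, G = ∑ μ, c μ • (μ.parts.map (hGen K)).prod := by
  have : G ∈ Submodule.span K
      (Set.range fun μ : n.Partition => (μ.parts.map (hGen K)).prod) := by
    refine Submodule.span_mono ?_ hG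
    rintro _ ⟨s, hs, rfl⟩
    exact ⟨Nat.Partition.ofSums n s hs, prod_map_hGen_filter s⟩
  obtain ⟨c, hc⟩ := (Submodule.mem_span_range_iff_exists_fun K).1 this
  exact ⟨c, hc.symm⟩

theorem evalH_prod_map_hGen {n : ℕ} (μ : n.Partition) :
    evalH K (μ.parts.map (hGen K)).prod = completeSymmPart K μ := by
  rw [map_multiset_prod, Multiset.map_map, completeSymmPart]
  congr 2
  funext k
  exact evalH_hGen k

/-- Newton's identity. -/
theorem newton_completeSymm (k : ℕ) :
    (k : K) • completeSymm K k =
      ∑ i ∈ Finset.range k, powerSum K (i + 1) * completeSymm K (k - 1 - i) := by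
  ext d
  rw [map_smul, map_sum, smul_eq_mul, coeff_completeSymm]
  simp only [coeff_powerSum_mul (Nat.succ_pos _), coeff_completeSymm]
  have hdeg : ∀ i j, i + 1 ≤ d j → (d - Finsupp.single j (i + 1)).degree + (i + 1) = d.degree := by
    intro i j h
    conv_rhs => rw [← tsub_add_cancel_of_le (Finsupp.single_le_iff.2 h)]
    rw [map_add, Finsupp.degree_single]
  split_ifs with hd
  · have h1 : ∀ i ∈ Finset.range k,
        (∑ j ∈ d.support with i + 1 ≤ d j,
          if (d - Finsupp.single j (i + 1)).degree = k - 1 - i then (1 : K) else 0) =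
        ∑ j ∈ d.support, if i + 1 ≤ d j then (1 : K) else 0 := by
      intro i hi
      rw [Finset.sum_filter]
      refine Finset.sum_congr rfl fun j _ => ?_
      split_ifs with h2 h3
      · rfl
      · have := hdeg i j h2
        omega
      · rfl
    rw [Finset.sum_congr rfl h1, Finset.sum_comm]
    -- The variable `x_j` contributes to the terms of `p_1, …, p_{d j}`, hence `d j` times; summing
    -- over `j` gives the degree.
    have h2 : ∀ j ∈ d.support,
        (∑ i ∈ Finset.range k, if i + 1 ≤ d j then (1 : K) else 0) = (d j : K) := by
      intro j _
      rw [Finset.sum_boole]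
      congr 1
      have : d j ≤ k := hd ▸ Finsupp.le_degree j d
      have : (Finset.range k).filter (fun i => i + 1 ≤ d j) = Finset.range (d j) := by
        ext i
        simp only [Finset.mem_filter, Finset.mem_range]
        omega
      rw [this, Finset.card_range]
    rw [Finset.sum_congr rfl h2, ← Nat.cast_sum, mul_one]
    congr 1
    exact hd.symm
  · rw [mul_zero]
    symm
    refine Finset.sum_eq_zero fun i hi => Finset.sum_eq_zero fun j hj => if_neg fun h => hd ?_
    have : k - 1 - i + (i + 1) = d.degree := h ▸ hdeg i j (Finset.mem_filter.1 hj).2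
    rw [Finset.mem_range] at hi
    omega

/-- The last term of Newton's identity is `p_k h_0 = p_k`, so the identity can be solved for `p_k`
without division. -/
theorem powerSum_mem_map_hSpan (k : ℕ) (hk : 0 < k) :
    powerSum K k ∈ (hSpan K k).map (evalH K).toLinearMap := by
  induction k using Nat.strong_induction_on with
  | _ k ih =>
    obtain ⟨m, rfl⟩ := Nat.exists_eq_succ_of_ne_zero hk.ne'
    have h := newton_completeSymm (K := K) (m + 1)
    rw [Finset.sum_range_succ] at h
    have h0 : m + 1 - 1 - m = 0 := by omega
    rw [h0, completeSymm_zero, mul_one] at h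
    rw [Nat.succ_eq_add_one, ← sub_eq_of_eq_add' h]
    refine Submodule.sub_mem _ ?_ (Submodule.sum_mem _ fun i hi => ?_)
    · exact Submodule.smul_mem _ _ ⟨_, hGen_mem_hSpan _, evalH_hGen _⟩
    · rw [Finset.mem_range] at hi
      obtain ⟨G, hG, hG2⟩ := ih (i + 1) (by omega) (by omega)
      refine ⟨G * hGen K (m + 1 - 1 - i), ?_, ?_⟩
      · have h1 := mul_mem_hSpan hG (hGen_mem_hSpan (m + 1 - 1 - i))
        have h2 : i + 1 + (m + 1 - 1 - i) = m + 1 := by omega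
        rwa [h2] at h1
      · rw [AlgHom.toLinearMap_apply, map_mul, evalH_hGen, ← hG2, AlgHom.toLinearMap_apply]

theorem powerSum_prod_mem_map_hSpan (s : Multiset ℕ) (hs : ∀ k ∈ s, 0 < k) :
    (s.map (powerSum K)).prod ∈ (hSpan K s.sum).map (evalH K).toLinearMap := by
  induction s using Multiset.induction_on with
  | empty => exact ⟨1, one_mem_hSpan, by simp⟩
  | cons a s ih =>
    obtain ⟨G, hG, hG2⟩ := ih fun k hk => hs k (by simp [hk])
    obtain ⟨F, hF, hF2⟩ := powerSum_mem_map_hSpan (K := K) a (hs a (by simp))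
    refine ⟨F * G, ?_, ?_⟩
    · rw [Multiset.sum_cons]
      exact mul_mem_hSpan hF hG
    · rw [Multiset.map_cons, Multiset.prod_cons, ← hG2, ← hF2]
      simp

/-- Writing each `p_μ` in the `h_ν` factors the invertible `powerMatrix` through the coefficient
matrix of the `h_ν`, which is therefore invertible. -/
theorem completeSymmPart_injective [CharZero K] {n : ℕ} {c c' : n.Partition → K}
    (h : ∑ μ, c μ • completeSymmPart K μ = ∑ μ, c' μ • completeSymmPart K μ) : c = c' := by
  classical
  have hA : ∀ μ : n.Partition, ∃ a : n.Partition → K,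
      powerSumPart K μ = ∑ ν, a ν • completeSymmPart K ν := by
    intro μ
    obtain ⟨G, hG, hG2⟩ := powerSum_prod_mem_map_hSpan (K := K) μ.parts fun k => μ.parts_pos
    rw [μ.parts_sum] at hG
    obtain ⟨a, rfl⟩ := exists_eq_sum_of_mem_hSpan hG
    refine ⟨a, ?_⟩
    rw [powerSumPart, ← hG2]
    simp [evalH_prod_map_hGen]
  choose A hA using hA
  let H : Matrix n.Partition n.Partition K := fun μ ν => coeff (partExp ν) (completeSymmPart K μ)
  have hP : powerMatrix K n = Matrix.of A * H := by
    ext μ ν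
    rw [powerMatrix, hA, coeff_sum_smul]
    rfl
  have hH : IsUnit H := by
    have := isUnit_powerMatrix (K := K) n
    rw [Matrix.isUnit_iff_isUnit_det] at this ⊢
    rw [hP, Matrix.det_mul] at this
    exact isUnit_of_mul_isUnit_right this
  apply Matrix.vecMul_injective_iff_isUnit.2 hH
  funext ν
  have := congrArg (coeff (partExp ν)) h
  rwa [coeff_sum_smul, coeff_sum_smul] at this

/-- The pairing of `p_μ` with `h_ν` is the coefficient of `x^ν` in `p_μ`, which `coeff_powerSumPart`
computes by skewing. Uniqueness of the power sum expansion plays no role: `powerSumSubst` uses the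
same chosen coefficients. -/
theorem hallInner_evalH [CharZero K] {n : ℕ} {f : MvPowerSeries ℕ K}
    (hf : IsHomogeneousSymmetric n f) {G : MvPolynomial ℕ K} (hG : G ∈ hSpan K n) :
    hallInner n f (evalH K G) = ∑ μ : n.Partition, expansion (powerSumPart K) f μ *
      MvPolynomial.constantCoeff (skewDList μ.parts.toList G) := by
  obtain ⟨c, hc⟩ := exists_eq_sum_of_mem_hSpan hG
  have hev : evalH K G = ∑ μ, c μ • completeSymmPart K μ := by
    simp [hc, evalH_prod_map_hGen]
  have hexp : expansion (completeSymmPart K) (evalH K G) = c :=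
    completeSymmPart_injective ((expansion_spec ⟨c, hev⟩).symm.trans hev)
  rw [hallInner, hexp]
  simp only [expansion_monomialSymm ⟨_, eq_sum_monomialSymm_of_isHomogeneousSymmetric hf⟩]
  conv_lhs => rw [expansion_spec (exists_powerSum_expansion hf)]
  simp only [coeff_sum_smul, Finset.sum_mul]
  rw [Finset.sum_comm]
  refine Finset.sum_congr rfl fun μ _ => ?_
  rw [hc, skewDList_sum, map_sum, Finset.mul_sum]
  refine Finset.sum_congr rfl fun ν _ => ?_
  rw [skewDList_smul, MvPolynomial.smul_eq_C_mul, map_mul, MvPolynomial.constantCoeff_C,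
    ← hMonomial_partExp, coeff_powerSumPart]
  ring

end CompleteBasis

end SymFun

namespace SymFun

/-! ### Derivations acting on secant and tangent series. -/

section TrigonometricSeries

open PowerSeries (coeff mk)

variable {K : Type*} [Field K] {A : Type*} [CommRing A] [Algebra K A]

/-- A derivation applied coefficientwise to a power series. -/
noncomputable def coeffD (D : Derivation K A A) (F : PowerSeries A) : PowerSeries A :=
  mk fun n => D (coeff n F)

theorem coeff_coeffD (D : Derivation K A A) (F : PowerSeries A) (n : ℕ) :
    coeff n (coeffD D F) = D (coeff n F) := PowerSeries.coeff_mk _ _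

theorem coeffD_mul (D : Derivation K A A) (F G : PowerSeries A) :
    coeffD D (F * G) = F * coeffD D G + G * coeffD D F := by
  ext n
  rw [mul_comm G, coeff_coeffD, map_add, PowerSeries.coeff_mul, PowerSeries.coeff_mul,
    PowerSeries.coeff_mul, map_sum, ← Finset.sum_add_distrib]
  refine Finset.sum_congr rfl fun p _ => ?_
  rw [Derivation.leibniz, coeff_coeffD, coeff_coeffD, smul_eq_mul, smul_eq_mul,
    mul_comm (coeff p.2 G)]

theorem coeffD_one (D : Derivation K A A) : coeffD D 1 = 0 := by
  ext n
  rw [coeff_coeffD, PowerSeries.coeff_one]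
  split_ifs <;> simp

/-- The quotient rule `D(1/F) = -D F / F²`, from differentiating `G F = 1`. -/
theorem coeffD_of_mul_eq_one (D : Derivation K A A) {F G : PowerSeries A} (h : G * F = 1) :
    coeffD D G = -(G * (G * coeffD D F)) := by
  have h1 := coeffD_mul D G F
  rw [h, coeffD_one] at h1
  linear_combination -G * h1 - coeffD D G * h

/-- The series `∑ (-1)^m g_{2m} t^{2m}`. -/
noncomputable def cosSeries (g : ℕ → A) : PowerSeries A :=
  mk fun n => if Even n then (-1) ^ (n / 2) * g n else 0

/-- The series `∑ (-1)^m g_{2m+1} t^{2m+1}`. -/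
noncomputable def sinSeries (g : ℕ → A) : PowerSeries A :=
  mk fun n => if Even n then 0 else (-1) ^ (n / 2) * g n

variable {D : Derivation K A A} {g : ℕ → A} {s : K}

/-- In the application `s` is `1` for `g = h` and `-1` for `g = e`; the factor `(-1)^m` comes from
shifting the alternating signs. For odd shifts both families have scalar `1`, and cosine and sine
are exchanged as under differentiation. -/
theorem coeffD_cosSeries_even {m : ℕ}
    (hg : ∀ n, D (g n) = if 2 * m ≤ n then s • g (n - 2 * m) else 0) :
    coeffD D (cosSeries g) = (s * (-1) ^ m) • (PowerSeries.X ^ (2 * m) * cosSeries g) := by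
  ext n
  rw [coeff_coeffD, PowerSeries.coeff_smul, PowerSeries.coeff_X_pow_mul', cosSeries,
    PowerSeries.coeff_mk, PowerSeries.coeff_mk]
  rcases Nat.even_or_odd' n with ⟨j, rfl | rfl⟩
  · rw [if_pos (by simp), Nat.mul_div_cancel_left _ two_pos]
    have : D ((-1) ^ j * g (2 * j)) = (-1) ^ j * D (g (2 * j)) := by
      rcases neg_one_pow_eq_or A j with h | h <;> simp [h]
    rw [this, hg]
    split_ifs with h1 h3
    · obtain ⟨i, rfl⟩ := Nat.exists_eq_add_of_le (show m ≤ j by omega)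
      have h2 : 2 * (m + i) - 2 * m = 2 * i := by omega
      rw [h2, Nat.mul_div_cancel_left _ two_pos, pow_add]
      rcases neg_one_pow_eq_or K m with h | h
      · have h' : (-1 : A) ^ m = 1 := by simpa using congrArg (algebraMap K A) h
        simp [h, h']
      · have h' : (-1 : A) ^ m = -1 := by simpa using congrArg (algebraMap K A) h
        simp [h, h']
    · rw [Nat.even_sub h1] at h3
      simp at h3
    · simp
  · rw [if_neg (by simp)]
    split_ifs with h1 h2
    · rw [Nat.even_sub h1] at h2
      simp at h2
    · simp
    · simp

theorem coeffD_sinSeries_even {m : ℕ}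
    (hg : ∀ n, D (g n) = if 2 * m ≤ n then s • g (n - 2 * m) else 0) :
    coeffD D (sinSeries g) = (s * (-1) ^ m) • (PowerSeries.X ^ (2 * m) * sinSeries g) := by
  ext n
  rw [coeff_coeffD, PowerSeries.coeff_smul, PowerSeries.coeff_X_pow_mul', sinSeries,
    PowerSeries.coeff_mk, PowerSeries.coeff_mk]
  rcases Nat.even_or_odd' n with ⟨j, rfl | rfl⟩
  · rw [if_pos (by simp)]
    split_ifs with h1 h2
    · simp
    · rw [Nat.even_sub h1] at h2
      simp at h2
    · simp
  · rw [if_neg (by simp), show (2 * j + 1) / 2 = j by omega]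
    have : D ((-1) ^ j * g (2 * j + 1)) = (-1) ^ j * D (g (2 * j + 1)) := by
      rcases neg_one_pow_eq_or A j with h | h <;> simp [h]
    rw [this, hg]
    split_ifs with h1 h3
    · rw [Nat.even_sub h1] at h3
      simp at h3
    · obtain ⟨i, rfl⟩ := Nat.exists_eq_add_of_le (show m ≤ j by omega)
      have h2 : 2 * (m + i) + 1 - 2 * m = 2 * i + 1 := by omega
      rw [h2, show (2 * i + 1) / 2 = i by omega, pow_add]
      rcases neg_one_pow_eq_or K m with h | h
      · have h' : (-1 : A) ^ m = 1 := by simpa using congrArg (algebraMap K A) h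
        simp [h, h']
      · have h' : (-1 : A) ^ m = -1 := by simpa using congrArg (algebraMap K A) h
        simp [h, h']
    · simp

theorem coeffD_cosSeries_odd {m : ℕ}
    (hg : ∀ n, D (g n) = if 2 * m + 1 ≤ n then g (n - (2 * m + 1)) else 0) :
    coeffD D (cosSeries g) = -((-1 : K) ^ m) • (PowerSeries.X ^ (2 * m + 1) * sinSeries g) := by
  ext n
  rw [coeff_coeffD, PowerSeries.coeff_smul, PowerSeries.coeff_X_pow_mul', cosSeries, sinSeries,
    PowerSeries.coeff_mk, PowerSeries.coeff_mk]
  rcases Nat.even_or_odd' n with ⟨j, rfl | rfl⟩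
  · rw [if_pos (by simp), Nat.mul_div_cancel_left _ two_pos]
    have : D ((-1) ^ j * g (2 * j)) = (-1) ^ j * D (g (2 * j)) := by
      rcases neg_one_pow_eq_or A j with h | h <;> simp [h]
    rw [this, hg]
    split_ifs with h1 h3
    · rw [Nat.even_sub h1] at h3
      simp at h3
    · obtain ⟨i, rfl⟩ := Nat.exists_eq_add_of_le (show m + 1 ≤ j by omega)
      have h2 : 2 * (m + 1 + i) - (2 * m + 1) = 2 * i + 1 := by omega
      rw [h2, show (2 * i + 1) / 2 = i by omega, pow_add, pow_succ]
      rcases neg_one_pow_eq_or K m with h | h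
      · have h' : (-1 : A) ^ m = 1 := by simpa using congrArg (algebraMap K A) h
        simp [h, h']
      · have h' : (-1 : A) ^ m = -1 := by simpa using congrArg (algebraMap K A) h
        simp [h, h']
    · simp
  · rw [if_neg (by simp)]
    split_ifs with h1 h2
    · simp
    · rw [Nat.even_sub h1] at h2
      simp at h2
    · simp

theorem coeffD_sinSeries_odd {m : ℕ}
    (hg : ∀ n, D (g n) = if 2 * m + 1 ≤ n then g (n - (2 * m + 1)) else 0) :
    coeffD D (sinSeries g) = ((-1 : K) ^ m) • (PowerSeries.X ^ (2 * m + 1) * cosSeries g) := by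
  ext n
  rw [coeff_coeffD, PowerSeries.coeff_smul, PowerSeries.coeff_X_pow_mul', cosSeries, sinSeries,
    PowerSeries.coeff_mk, PowerSeries.coeff_mk]
  rcases Nat.even_or_odd' n with ⟨j, rfl | rfl⟩
  · rw [if_pos (by simp)]
    split_ifs with h1 h2
    · rw [Nat.even_sub h1] at h2
      simp at h2
    · simp
    · simp
  · rw [if_neg (by simp), show (2 * j + 1) / 2 = j by omega]
    have : D ((-1) ^ j * g (2 * j + 1)) = (-1) ^ j * D (g (2 * j + 1)) := by
      rcases neg_one_pow_eq_or A j with h | h <;> simp [h]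
    rw [this, hg]
    split_ifs with h1 h3
    · obtain ⟨i, rfl⟩ := Nat.exists_eq_add_of_le (show m ≤ j by omega)
      have h2 : 2 * (m + i) + 1 - (2 * m + 1) = 2 * i := by omega
      rw [h2, Nat.mul_div_cancel_left _ two_pos, pow_add]
      rcases neg_one_pow_eq_or K m with h | h
      · have h' : (-1 : A) ^ m = 1 := by simpa using congrArg (algebraMap K A) h
        simp [h, h']
      · have h' : (-1 : A) ^ m = -1 := by simpa using congrArg (algebraMap K A) h
        simp [h, h']
    · rw [Nat.even_sub h1] at h3
      simp at h3
    · simp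

variable {Q : PowerSeries A}

theorem coeffD_sec_even {m : ℕ} (hQ : Q * cosSeries g = 1)
    (hg : ∀ n, D (g n) = if 2 * m ≤ n then s • g (n - 2 * m) else 0) :
    coeffD D Q = -(s * (-1) ^ m) • (PowerSeries.X ^ (2 * m) * Q) := by
  rw [coeffD_of_mul_eq_one D hQ, coeffD_cosSeries_even hg, neg_smul, mul_smul_comm,
    mul_smul_comm]
  congr 2
  linear_combination PowerSeries.X ^ (2 * m) * Q * hQ

theorem coeffD_sec_odd {m : ℕ} (hQ : Q * cosSeries g = 1)
    (hg : ∀ n, D (g n) = if 2 * m + 1 ≤ n then g (n - (2 * m + 1)) else 0) :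
    coeffD D Q = ((-1 : K) ^ m) • (PowerSeries.X ^ (2 * m + 1) * (Q * (Q * sinSeries g))) := by
  rw [coeffD_of_mul_eq_one D hQ, coeffD_cosSeries_odd hg, neg_smul, mul_neg, mul_neg, neg_neg,
    mul_smul_comm, mul_smul_comm]
  congr 1
  ring

/-- Sine and cosine acquire the same factor, which cancels in the derivative of their quotient. -/
theorem coeffD_tan_even {m : ℕ} (hQ : Q * cosSeries g = 1)
    (hg : ∀ n, D (g n) = if 2 * m ≤ n then s • g (n - 2 * m) else 0) :
    coeffD D (Q * sinSeries g) = 0 := by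
  rw [coeffD_mul, coeffD_sec_even hQ hg, coeffD_sinSeries_even hg, neg_smul, mul_neg,
    mul_smul_comm, mul_smul_comm, ← sub_eq_add_neg, ← smul_sub]
  convert smul_zero _
  ring

/-- The numerator of the quotient rule is `cos² + sin²`, which need not be `1`; divided by `cos²` it
is `1 + tan²`. -/
theorem coeffD_tan_odd {m : ℕ} (hQ : Q * cosSeries g = 1)
    (hg : ∀ n, D (g n) = if 2 * m + 1 ≤ n then g (n - (2 * m + 1)) else 0) :
    coeffD D (Q * sinSeries g) =
      ((-1 : K) ^ m) • (PowerSeries.X ^ (2 * m + 1) * (1 + (Q * sinSeries g) ^ 2)) := by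
  rw [coeffD_mul, coeffD_sec_odd hQ hg, coeffD_sinSeries_odd hg,
    mul_smul_comm, mul_smul_comm, ← smul_add]
  congr 1
  linear_combination PowerSeries.X ^ (2 * m + 1) * hQ

end TrigonometricSeries

/-! ### Iterated skewing and umbral evaluation. -/

section Evaluation

open PowerSeries (coeff mk)

variable {K : Type*} [Field K]

/-- The compatibility of a sequence with the operators `p_k^⊥`, with scalars `ε k`. -/
def IsSkewCompatible (ε : ℕ → K) (F : ℕ → MvPolynomial ℕ K) : Prop :=
  ∀ k n, 0 < k → k ≤ n →
    skewD K k (F n) = ε k • if Even k then F (n - k) else skewD K 1 (F (n + 1 - k))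

/-- Since the operators commute, applying `p_1^⊥` to the relation gives it for the shifted sequence.
This lets an induction absorb an odd part by changing the sequence. -/
theorem IsSkewCompatible.shift {ε : ℕ → K} {F : ℕ → MvPolynomial ℕ K}
    (h : IsSkewCompatible ε F) : IsSkewCompatible ε fun n => skewD K 1 (F (n + 1)) := by
  intro k n hk hn
  rw [skewD_comm hk one_pos, h k (n + 1) hk (by omega), Derivation.map_smul]
  congr 1
  split_ifs with hev
  · rw [show n + 1 - k = n - k + 1 by omega]
  · rw [show n + 1 + 1 - k = n + 1 - k + 1 by omega]

/-- An even part only lowers the index; an odd part is traded for one `p_1^⊥`. So there remain as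
many `p_1^⊥` as odd parts, acting on the term of that index. -/
theorem constantCoeff_skewDList {ε : ℕ → K} {l : List ℕ} (hl : ∀ k ∈ l, 0 < k)
    {F : ℕ → MvPolynomial ℕ K} (h : IsSkewCompatible ε F) :
    MvPolynomial.constantCoeff (skewDList l (F l.sum)) =
      (l.map ε).prod * MvPolynomial.constantCoeff
        ((skewD K 1)^[l.countP (fun k => ¬ Even k)] (F (l.countP (fun k => ¬ Even k)))) := by
  induction l generalizing F with
  | nil => simp [skewDList]
  | cons k l ih =>
    have hk : 0 < k := hl k (by simp)
    have hl' : ∀ k ∈ l, 0 < k := fun k hk => hl k (by simp [hk])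
    have h1 : skewDList (k :: l) (F (k :: l).sum) =
        skewDList l (skewD K k (F (k :: l).sum)) := rfl
    rw [h1, h k _ hk (by simp), skewDList_smul, MvPolynomial.smul_eq_C_mul, map_mul,
      MvPolynomial.constantCoeff_C, List.map_cons, List.prod_cons, List.sum_cons, mul_assoc]
    congr 1
    split_ifs with hev
    · rw [Nat.add_sub_cancel_left, ih hl' h, List.countP_cons_of_neg (by simpa using hev)]
    · rw [show k + l.sum + 1 - k = l.sum + 1 by omega, ih hl' h.shift,
        List.countP_cons_of_pos (by simpa using hev), Function.iterate_succ_apply]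

/-- For odd `k` the derivative is `± t^k sec · tan`. The case `k = 1` expresses `t sec · tan` as a
`p_1^⊥`-derivative, so the product can be eliminated. -/
theorem isSkewCompatible_sec {c : K} {g : ℕ → MvPolynomial ℕ K}
    {Q : PowerSeries (MvPolynomial ℕ K)} (hQ : Q * cosSeries g = 1)
    (hg : ∀ k n, 0 < k → skewD K k (g n) =
      if k ≤ n then (if Even k then c else 1) • g (n - k) else 0) :
    IsSkewCompatible (periodicFour 1 c (-1) (-c)) fun n => coeff n Q := by
  intro k n hk hn
  rcases Nat.even_or_odd' k with ⟨m, rfl | rfl⟩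
  · have h1 := congrArg (coeff n) (coeffD_sec_even (D := skewD K (2 * m)) (s := c) (m := m) hQ
      fun n => by rw [hg _ _ hk, if_pos (by simp : Even (2 * m))])
    rw [coeff_coeffD, PowerSeries.coeff_smul, PowerSeries.coeff_X_pow_mul', if_pos hn] at h1
    rw [h1, if_pos (by simp)]
    congr 1
    rcases Nat.even_or_odd' m with ⟨j, rfl | rfl⟩
    · have : 2 * (2 * j) % 4 = 0 := by omega
      simp [periodicFour, this]
    · have : 2 * (2 * j + 1) % 4 = 2 := by omega
      simp [periodicFour, this, pow_succ]
  · have hodd : ∀ m, ¬ Even (2 * m + 1) := by simp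
    have h1 := congrArg (coeff n) (coeffD_sec_odd (D := skewD K (2 * m + 1)) (m := m) hQ
      fun n => by rw [hg _ _ hk, if_neg (hodd m), one_smul])
    have h2 := congrArg (coeff (n + 1 - (2 * m + 1))) (coeffD_sec_odd (D := skewD K 1) (m := 0) hQ
      fun n => by simpa using hg 1 n one_pos)
    rw [coeff_coeffD, PowerSeries.coeff_smul, PowerSeries.coeff_X_pow_mul', if_pos hn] at h1
    rw [coeff_coeffD, PowerSeries.coeff_smul, PowerSeries.coeff_X_pow_mul',
      if_pos (by omega), pow_zero, one_smul] at h2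
    rw [h1, if_neg (hodd m), h2, show n + 1 - (2 * m + 1) - (2 * 0 + 1) = n - (2 * m + 1) by omega]
    congr 1
    rcases Nat.even_or_odd' m with ⟨j, rfl | rfl⟩
    · have : (2 * (2 * j) + 1) % 4 = 1 := by omega
      simp [periodicFour, this]
    · have : (2 * (2 * j + 1) + 1) % 4 = 3 := by omega
      simp [periodicFour, this, pow_succ]

/-- The even entries are `0` whatever `c` is. Writing `-0` keeps the pattern `1, c, -1, -c` that
`hallInner_eq_umbral` expects, at `c = 0`. -/
theorem isSkewCompatible_tan {c : K} {g : ℕ → MvPolynomial ℕ K}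
    {Q : PowerSeries (MvPolynomial ℕ K)} (hQ : Q * cosSeries g = 1)
    (hg : ∀ k n, 0 < k → skewD K k (g n) =
      if k ≤ n then (if Even k then c else 1) • g (n - k) else 0) :
    IsSkewCompatible (periodicFour 1 0 (-1) (-0)) fun n => coeff n (Q * sinSeries g) := by
  intro k n hk hn
  rcases Nat.even_or_odd' k with ⟨m, rfl | rfl⟩
  · have h1 := congrArg (coeff n) (coeffD_tan_even (D := skewD K (2 * m)) (s := c) (m := m) hQ
      fun n => by rw [hg _ _ hk, if_pos (by simp : Even (2 * m))])
    rw [coeff_coeffD, map_zero] at h1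
    rw [h1]
    have : periodicFour (1 : K) 0 (-1) (-0) (2 * m) = 0 := by
      rcases Nat.even_or_odd' m with ⟨j, rfl | rfl⟩
      · have : 2 * (2 * j) % 4 = 0 := by omega
        simp [periodicFour, this]
      · have : 2 * (2 * j + 1) % 4 = 2 := by omega
        simp [periodicFour, this]
    rw [this, zero_smul]
  · have hodd : ∀ m, ¬ Even (2 * m + 1) := by simp
    have h1 := congrArg (coeff n) (coeffD_tan_odd (D := skewD K (2 * m + 1)) (m := m) hQ
      fun n => by rw [hg _ _ hk, if_neg (hodd m), one_smul])
    have h2 := congrArg (coeff (n + 1 - (2 * m + 1))) (coeffD_tan_odd (D := skewD K 1) (m := 0) hQ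
      fun n => by simpa using hg 1 n one_pos)
    rw [coeff_coeffD, PowerSeries.coeff_smul, PowerSeries.coeff_X_pow_mul', if_pos hn] at h1
    rw [coeff_coeffD, PowerSeries.coeff_smul, PowerSeries.coeff_X_pow_mul',
      if_pos (by omega), pow_zero, one_smul] at h2
    rw [h1, if_neg (hodd m), h2, show n + 1 - (2 * m + 1) - (2 * 0 + 1) = n - (2 * m + 1) by omega]
    congr 1
    rcases Nat.even_or_odd' m with ⟨j, rfl | rfl⟩
    · have : (2 * (2 * j) + 1) % 4 = 1 := by omega
      simp [periodicFour, this]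
    · have : (2 * (2 * j + 1) + 1) % 4 = 3 := by omega
      simp [periodicFour, this, pow_succ]

theorem umbral_sum {ι : Type*} (s : Finset ι) (P : ι → Polynomial K) :
    umbral (∑ i ∈ s, P i) = ∑ i ∈ s, umbral (P i) := by
  induction s using Finset.cons_induction with
  | empty => simp [umbral]
  | cons a s ha ih =>
    rw [Finset.sum_cons, Finset.sum_cons, ← ih, umbral, Polynomial.sum_add_index]
    · rfl
    · simp
    · intros; ring

theorem umbral_C_mul_X_pow (a : K) (n : ℕ) :
    umbral (Polynomial.C a * Polynomial.X ^ n) = a * (eulerNumber n : K) := by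
  rw [Polynomial.C_mul_X_pow_eq_monomial, umbral, Polynomial.sum_monomial_index]
  simp

theorem periodicFour_X (c : K) (k : ℕ) :
    periodicFour Polynomial.X (Polynomial.C c) (-Polynomial.X) (-Polynomial.C c) k =
      Polynomial.C (periodicFour 1 c (-1) (-c) k) *
        Polynomial.X ^ (if Even k then 0 else 1) := by
  have h := Nat.mod_lt k (show 4 > 0 by norm_num)
  have hk : Even k ↔ Even (k % 4) := by
    rw [Nat.even_iff, Nat.even_iff]
    omega
  simp only [hk, periodicFour]
  generalize k % 4 = j at h
  interval_cases j <;> simp [show ¬ Even 3 by decide]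

theorem prod_periodicFour_X (c : K) (l : List ℕ) :
    (l.map (periodicFour Polynomial.X (Polynomial.C c) (-Polynomial.X) (-Polynomial.C c))).prod =
      Polynomial.C (l.map (periodicFour 1 c (-1) (-c))).prod *
        Polynomial.X ^ l.countP (fun k => ¬ Even k) := by
  induction l with
  | nil => simp
  | cons k l ih =>
    rw [List.map_cons, List.prod_cons, ih, periodicFour_X, List.map_cons, List.prod_cons,
      List.countP_cons, Polynomial.C_mul, pow_add]
    by_cases hk : Even k
    · simp [hk]; ring
    · simp [hk]; ring

/-- Only Euler numbers with index of the parity of `n` occur, so the secant or the tangent series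
alone suffices. -/
theorem even_countP_odd_iff (l : List ℕ) :
    Even (l.countP fun k => ¬ Even k) ↔ Even l.sum := by
  induction l with
  | nil => simp
  | cons k l ih =>
    rw [List.countP_cons, List.sum_cons, Nat.even_add, Nat.even_add, ih]
    by_cases hk : Even k <;> simp [hk]

/-- For `μ` with `r` odd parts, both the skewing and the substitution produce the product of the `ε`
values over the parts. It multiplies a squarefree coefficient on one side and `X^r` on the other,
and `hE` identifies the former with `E_r`. -/
theorem hallInner_eq_umbral [CharZero K] {n : ℕ} {f : MvPowerSeries ℕ K}
    (hf : IsHomogeneousSymmetric n f) {c : K} {F : ℕ → MvPolynomial ℕ K}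
    (hF : IsSkewCompatible (periodicFour 1 c (-1) (-c)) F) (hspan : F n ∈ hSpan K n)
    (hE : ∀ r, (Even r ↔ Even n) →
      MvPowerSeries.coeff (∑ i ∈ Finset.range r, Finsupp.single i 1) (evalH K (F r)) =
        (eulerNumber r : K)) :
    hallInner n f (evalH K (F n)) =
      umbral (powerSumSubst n f (periodicFour Polynomial.X (Polynomial.C c) (-Polynomial.X)
        (-Polynomial.C c))) := by
  rw [hallInner_evalH hf hspan, powerSumSubst, umbral_sum]
  refine Finset.sum_congr rfl fun μ _ => ?_
  have hsum : μ.parts.toList.sum = n := by rw [Multiset.sum_toList, μ.parts_sum]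
  have h1 := constantCoeff_skewDList
    (fun k hk => μ.parts_pos (Multiset.mem_toList.1 hk)) hF
  rw [← coeff_evalH_eq_iterate, hE _ (by rw [even_countP_odd_iff, hsum]), hsum] at h1
  have h2 : ∀ a : ℕ → Polynomial K, (μ.parts.map a).prod = (μ.parts.toList.map a).prod := by
    intro a
    rw [← Multiset.prod_coe, ← Multiset.map_coe, Multiset.coe_toList]
  rw [h1, h2, prod_periodicFour_X, ← Polynomial.C_mul', ← mul_assoc, ← mul_assoc,
    ← Polynomial.C_mul, umbral_C_mul_X_pow]

end Evaluation

end SymFun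

namespace SymFun

/-! ### Homogeneity and parity of the coefficients; elementary symmetric functions. -/

section SecantTangent

open PowerSeries (coeff mk)

variable {K : Type*} [Field K]

/-- Because the constant term is `1`, the coefficients of the inverse satisfy a recursion that
respects degrees. -/
theorem coeff_mem_of_mul_eq_one {F G : PowerSeries (MvPolynomial ℕ K)} (h : F * G = 1)
    (hF0 : coeff 0 F = 1) (hF : ∀ n, coeff n F ∈ hSpan K n) (n : ℕ) : coeff n G ∈ hSpan K n := by
  induction n using Nat.strong_induction_on with
  | _ n ih =>
    have h1 := congrArg (coeff n) h
    rw [PowerSeries.coeff_mul, Finset.Nat.sum_antidiagonal_eq_sum_range_succ_mk,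
      Finset.sum_range_succ', Nat.sub_zero, hF0, one_mul] at h1
    rw [show coeff n G = _ from eq_sub_of_add_eq' h1]
    refine Submodule.sub_mem _ ?_ (Submodule.sum_mem _ fun i hi => ?_)
    · rw [PowerSeries.coeff_one]
      split_ifs with hn
      · rw [hn]
        exact one_mem_hSpan
      · exact Submodule.zero_mem _
    · rw [Finset.mem_range] at hi
      have := mul_mem_hSpan (hF (i + 1)) (ih (n - (i + 1)) (by omega))
      rwa [show i + 1 + (n - (i + 1)) = n by omega] at this

theorem coeff_mul_mem_hSpan {F G : PowerSeries (MvPolynomial ℕ K)}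
    (hF : ∀ n, coeff n F ∈ hSpan K n) (hG : ∀ n, coeff n G ∈ hSpan K n) (n : ℕ) :
    coeff n (F * G) ∈ hSpan K n := by
  rw [PowerSeries.coeff_mul]
  refine Submodule.sum_mem _ fun p hp => ?_
  rw [← Finset.HasAntidiagonal.mem_antidiagonal.1 hp]
  exact mul_mem_hSpan (hF _) (hG _)

theorem neg_one_pow_mul_mem_hSpan {G : MvPolynomial ℕ K} {n : ℕ} (hG : G ∈ hSpan K n) (m : ℕ) :
    (-1) ^ m * G ∈ hSpan K n := by
  rcases neg_one_pow_eq_or (MvPolynomial ℕ K) m with h | h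
  · simpa [h]
  · simpa [h] using Submodule.neg_mem _ hG

variable {A : Type*} [CommRing A] {g : ℕ → A} {Q : PowerSeries A}

theorem coeff_cosSeries_of_odd {n : ℕ} (hn : ¬ Even n) : coeff n (cosSeries g) = 0 := by
  rw [cosSeries, PowerSeries.coeff_mk, if_neg hn]

theorem coeff_sinSeries_of_even {n : ℕ} (hn : Even n) : coeff n (sinSeries g) = 0 := by
  rw [sinSeries, PowerSeries.coeff_mk, if_pos hn]

theorem coeff_zero_cosSeries (hg : g 0 = 1) : coeff 0 (cosSeries g) = 1 := by
  rw [cosSeries, PowerSeries.coeff_mk]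
  simp [hg]

theorem coeff_sec_of_odd (hg : g 0 = 1) (hQ : Q * cosSeries g = 1) {n : ℕ} (hn : ¬ Even n) :
    coeff n Q = 0 := by
  induction n using Nat.strong_induction_on with
  | _ n ih =>
    have h1 := congrArg (coeff n) ((mul_comm _ _).trans hQ)
    rw [PowerSeries.coeff_mul, Finset.Nat.sum_antidiagonal_eq_sum_range_succ_mk,
      Finset.sum_range_succ', Nat.sub_zero, coeff_zero_cosSeries hg, one_mul,
      PowerSeries.coeff_one, if_neg (by rintro rfl; simp at hn), Finset.sum_eq_zero, zero_add]
      at h1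
    · exact h1
    · intro i hi
      rw [Finset.mem_range] at hi
      by_cases hev : Even (i + 1)
      · rw [ih (n - (i + 1)) (by omega), mul_zero]
        rw [Nat.even_sub (by omega)]
        tauto
      · rw [coeff_cosSeries_of_odd hev, zero_mul]

theorem coeff_tan_of_even (hg : g 0 = 1) (hQ : Q * cosSeries g = 1) {n : ℕ} (hn : Even n) :
    coeff n (Q * sinSeries g) = 0 := by
  rw [PowerSeries.coeff_mul]
  refine Finset.sum_eq_zero fun p hp => ?_
  rw [Finset.HasAntidiagonal.mem_antidiagonal] at hp
  by_cases hev : Even p.2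
  · rw [coeff_sinSeries_of_even hev, mul_zero]
  · rw [coeff_sec_of_odd hg hQ, zero_mul]
    rw [← hp, Nat.even_add] at hn
    tauto

theorem exists_mul_cosSeries_eq_one (hg : g 0 = 1) : ∃ Q, Q * cosSeries g = 1 :=
  ⟨_, PowerSeries.invOfUnit_mul _ 1 (by
    rw [← PowerSeries.coeff_zero_eq_constantCoeff_apply, coeff_zero_cosSeries hg, Units.val_one])⟩

theorem map_cosSeries {B : Type*} [CommRing B] (φ : A →+* B) :
    PowerSeries.map φ (cosSeries g) = cosSeries fun n => φ (g n) := by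
  ext n
  rw [PowerSeries.coeff_map, cosSeries, cosSeries, PowerSeries.coeff_mk, PowerSeries.coeff_mk]
  split_ifs <;> simp

theorem map_sinSeries {B : Type*} [CommRing B] (φ : A →+* B) :
    PowerSeries.map φ (sinSeries g) = sinSeries fun n => φ (g n) := by
  ext n
  rw [PowerSeries.coeff_map, sinSeries, sinSeries, PowerSeries.coeff_mk, PowerSeries.coeff_mk]
  split_ifs <;> simp

/-- Multiplying the equation for `F` by the image of the secant gives `F = sec + tan`. -/
theorem map_sec_add_map_tan [Algebra K A] {B : Type*} [CommRing B] [Algebra K B] (φ : A →ₐ[K] B)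
    (hQ : Q * cosSeries g = 1)
    {F : PowerSeries B}
    (hF : cosSeries (fun n => φ (g n)) * F = 1 + sinSeries fun n => φ (g n)) (n : ℕ) :
    coeff n F = φ (coeff n Q) + φ (coeff n (Q * sinSeries g)) := by
  have hF' : cosSeries (fun n => (φ : A →+* B) (g n)) * F =
      1 + sinSeries fun n => (φ : A →+* B) (g n) := hF
  have h1 := congrArg (PowerSeries.map (φ : A →+* B)) hQ
  rw [map_mul, map_one, map_cosSeries] at h1
  have h2 : F = PowerSeries.map (φ : A →+* B) Q +
      PowerSeries.map (φ : A →+* B) (Q * sinSeries g) := by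
    rw [map_mul, map_sinSeries]
    linear_combination PowerSeries.map (φ : A →+* B) Q * hF' - F * h1
  rw [h2, map_add, PowerSeries.coeff_map, PowerSeries.coeff_map]
  rfl

variable (K) in
/-- The series `∑ (-1)^n h_n t^n`. -/
noncomputable def hSeriesNeg : PowerSeries (MvPolynomial ℕ K) := mk fun n => (-1) ^ n * hGen K n

variable (K) in
/-- The generating series of the elementary symmetric functions. -/
noncomputable def eSeries : PowerSeries (MvPolynomial ℕ K) :=
  PowerSeries.invOfUnit (hSeriesNeg K) 1

variable (K) in
/-- The elementary symmetric function `e_n` as a polynomial in `h_1, h_2, …`. -/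
noncomputable def eGen (n : ℕ) : MvPolynomial ℕ K := coeff n (eSeries K)

theorem coeff_zero_hSeriesNeg : coeff 0 (hSeriesNeg K) = 1 := by
  rw [hSeriesNeg, PowerSeries.coeff_mk]
  simp [hGen]

theorem hSeriesNeg_mul_eSeries : hSeriesNeg K * eSeries K = 1 :=
  PowerSeries.mul_invOfUnit _ 1 (by
    rw [← PowerSeries.coeff_zero_eq_constantCoeff_apply, coeff_zero_hSeriesNeg, Units.val_one])

theorem eGen_mem_hSpan (n : ℕ) : eGen K n ∈ hSpan K n := by
  refine coeff_mem_of_mul_eq_one hSeriesNeg_mul_eSeries coeff_zero_hSeriesNeg (fun n => ?_) n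
  rw [hSeriesNeg, PowerSeries.coeff_mk]
  exact neg_one_pow_mul_mem_hSpan (hGen_mem_hSpan n) n

theorem eGen_zero : eGen K 0 = 1 := by
  have h := congrArg (coeff 0) (hSeriesNeg_mul_eSeries (K := K))
  rw [PowerSeries.coeff_mul] at h
  rw [eGen, PowerSeries.coeff_zero_eq_constantCoeff]
  simpa [coeff_zero_hSeriesNeg] using h

theorem coeffD_hSeriesNeg {k : ℕ} (hk : 0 < k) :
    coeffD (skewD K k) (hSeriesNeg K) = (-1 : K) ^ k • (PowerSeries.X ^ k * hSeriesNeg K) := by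
  ext n : 1
  rw [coeff_coeffD, PowerSeries.coeff_smul, PowerSeries.coeff_X_pow_mul', hSeriesNeg,
    PowerSeries.coeff_mk, PowerSeries.coeff_mk]
  have : skewD K k ((-1) ^ n * hGen K n) = (-1) ^ n * skewD K k (hGen K n) := by
    rcases neg_one_pow_eq_or (MvPolynomial ℕ K) n with h | h <;> simp [h]
  rw [this, skewD_hGen hk]
  split_ifs with h
  · obtain ⟨m, rfl⟩ := Nat.exists_eq_add_of_le h
    rw [Nat.add_sub_cancel_left, pow_add, MvPolynomial.smul_eq_C_mul, map_pow, map_neg, map_one,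
      mul_assoc]
  · simp

/-- As `p_k^⊥` multiplies `∑ (-1)^n h_n t^n` by `(-t)^k`, it multiplies the inverse series by
`-(-t)^k`. The sign for even `k` is what separates `τ_n` from its conjugate. -/
theorem skewD_eGen (k n : ℕ) (hk : 0 < k) :
    skewD K k (eGen K n) = if k ≤ n then (if Even k then (-1 : K) else 1) • eGen K (n - k)
      else 0 := by
  have h := coeffD_of_mul_eq_one (skewD K k) ((mul_comm _ _).trans (hSeriesNeg_mul_eSeries (K := K)))
  rw [coeffD_hSeriesNeg hk, mul_smul_comm, mul_smul_comm, ← neg_smul] at h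
  have h2 : eSeries K * (eSeries K * (PowerSeries.X ^ k * hSeriesNeg K)) =
      PowerSeries.X ^ k * eSeries K := by
    linear_combination PowerSeries.X ^ k * eSeries K * hSeriesNeg_mul_eSeries (K := K)
  have h3 := congrArg (coeff n) (h.trans (by rw [h2]))
  rw [coeff_coeffD, PowerSeries.coeff_smul, PowerSeries.coeff_X_pow_mul'] at h3
  rw [eGen, h3]
  split_ifs with h4 h5
  · rw [h5.neg_one_pow]
    rfl
  · rw [(Nat.not_even_iff_odd.1 h5).neg_one_pow, neg_neg]
    rfl
  · simp

theorem skewD_hGen' (k n : ℕ) (hk : 0 < k) :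
    skewD K k (hGen K n) = if k ≤ n then (if Even k then (1 : K) else 1) • hGen K (n - k)
      else 0 := by
  rw [skewD_hGen hk]
  simp

theorem coeff_sec_mem_hSpan {g : ℕ → MvPolynomial ℕ K} {Q : PowerSeries (MvPolynomial ℕ K)}
    (hg0 : g 0 = 1) (hg : ∀ n, g n ∈ hSpan K n) (hQ : Q * cosSeries g = 1) (n : ℕ) :
    coeff n Q ∈ hSpan K n := by
  refine coeff_mem_of_mul_eq_one ((mul_comm _ _).trans hQ) (coeff_zero_cosSeries hg0)
    (fun n => ?_) n
  rw [cosSeries, PowerSeries.coeff_mk]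
  split_ifs
  · exact neg_one_pow_mul_mem_hSpan (hg n) _
  · exact Submodule.zero_mem _

theorem coeff_tan_mem_hSpan {g : ℕ → MvPolynomial ℕ K} {Q : PowerSeries (MvPolynomial ℕ K)}
    (hg0 : g 0 = 1) (hg : ∀ n, g n ∈ hSpan K n) (hQ : Q * cosSeries g = 1) (n : ℕ) :
    coeff n (Q * sinSeries g) ∈ hSpan K n := by
  refine coeff_mul_mem_hSpan (coeff_sec_mem_hSpan hg0 hg hQ) (fun n => ?_) n
  rw [sinSeries, PowerSeries.coeff_mk]
  split_ifs
  · exact Submodule.zero_mem _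
  · exact neg_one_pow_mul_mem_hSpan (hg n) _

/-- Evaluation of the pairing with secant numbers: the shapes with an even number of cells. -/
theorem hallInner_sec [CharZero K] {n : ℕ} (hn : Even n) {f : MvPowerSeries ℕ K}
    (hf : IsHomogeneousSymmetric n f) {c : K} {g : ℕ → MvPolynomial ℕ K} (hg0 : g 0 = 1)
    (hg : ∀ n, g n ∈ hSpan K n)
    (hD : ∀ k n, 0 < k → skewD K k (g n) =
      if k ≤ n then (if Even k then c else 1) • g (n - k) else 0)
    {F : PowerSeries (MvPowerSeries ℕ K)}
    (hF : cosSeries (fun n => evalH K (g n)) * F = 1 + sinSeries fun n => evalH K (g n))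
    (hE : ∀ r, MvPowerSeries.coeff (∑ i ∈ Finset.range r, Finsupp.single i 1) (coeff r F) =
        (eulerNumber r : K)) :
    hallInner n f (coeff n F) =
      umbral (powerSumSubst n f (periodicFour Polynomial.X (Polynomial.C c) (-Polynomial.X)
        (-Polynomial.C c))) := by
  obtain ⟨Q, hQ⟩ := exists_mul_cosSeries_eq_one hg0
  -- The tangent has no even coefficients, so in even degrees `F` is the secant series alone.
  have key : ∀ r, Even r → coeff r F = evalH K (coeff r Q) := fun r hr => by
    rw [map_sec_add_map_tan (evalH K) hQ hF, coeff_tan_of_even hg0 hQ hr, map_zero,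
      add_zero]
  rw [key n hn]
  have hE' : ∀ r, (Even r ↔ Even n) → MvPowerSeries.coeff
      (∑ i ∈ Finset.range r, Finsupp.single i 1) (evalH K (coeff r Q)) = (eulerNumber r : K) :=
    fun r hr => by rw [← key r (hr.2 hn), hE]
  exact hallInner_eq_umbral (F := fun n => coeff n Q) hf (isSkewCompatible_sec hQ hD)
    (coeff_sec_mem_hSpan hg0 hg hQ n) hE'

/-- Evaluation of the pairing with tangent numbers: the shapes with an odd number of cells. -/
theorem hallInner_tan [CharZero K] {n : ℕ} (hn : ¬ Even n) {f : MvPowerSeries ℕ K}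
    (hf : IsHomogeneousSymmetric n f) {c : K} {g : ℕ → MvPolynomial ℕ K} (hg0 : g 0 = 1)
    (hg : ∀ n, g n ∈ hSpan K n)
    (hD : ∀ k n, 0 < k → skewD K k (g n) =
      if k ≤ n then (if Even k then c else 1) • g (n - k) else 0)
    {F : PowerSeries (MvPowerSeries ℕ K)}
    (hF : cosSeries (fun n => evalH K (g n)) * F = 1 + sinSeries fun n => evalH K (g n))
    (hE : ∀ r, MvPowerSeries.coeff (∑ i ∈ Finset.range r, Finsupp.single i 1) (coeff r F) =
        (eulerNumber r : K)) :
    hallInner n f (coeff n F) =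
      umbral (powerSumSubst n f (periodicFour Polynomial.X (Polynomial.C 0) (-Polynomial.X)
        (-Polynomial.C 0))) := by
  obtain ⟨Q, hQ⟩ := exists_mul_cosSeries_eq_one hg0
  have key : ∀ r, ¬ Even r → coeff r F = evalH K (coeff r (Q * sinSeries g)) := fun r hr => by
    rw [map_sec_add_map_tan (evalH K) hQ hF, coeff_sec_of_odd hg0 hQ hr, map_zero,
      zero_add]
  rw [key n hn]
  have hE' : ∀ r, (Even r ↔ Even n) → MvPowerSeries.coeff
      (∑ i ∈ Finset.range r, Finsupp.single i 1) (evalH K (coeff r (Q * sinSeries g))) =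
        (eulerNumber r : K) := fun r hr => by rw [← key r (hr.not.2 hn), hE]
  exact hallInner_eq_umbral (F := fun n => coeff n (Q * sinSeries g)) hf
    (isSkewCompatible_tan hQ hD) (coeff_tan_mem_hSpan hg0 hg hQ n) hE'

end SecantTangent

end SymFun

namespace SymFun

/-! ### Generating functions of chains and alternating words. -/

section Words

variable {K : Type*} [Field K]

/-- The words with given letter multiplicities. -/
noncomputable def words (d : ℕ →₀ ℕ) : Finset (List ℕ) :=
  (Finsupp.toMultiset d).toList.permutations.toFinset

theorem mem_words {d : ℕ →₀ ℕ} {l : List ℕ} : l ∈ words d ↔ (l : Multiset ℕ).toFinsupp = d := by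
  rw [words, List.mem_toFinset, List.mem_permutations, Multiset.toFinsupp_eq_iff,
    ← Multiset.coe_eq_coe, Multiset.coe_toList]

open Classical in
variable (K) in
/-- The generating function of the words with property `P`. -/
noncomputable def wordSeries (P : List ℕ → Prop) : MvPowerSeries ℕ K :=
  fun d : ℕ →₀ ℕ => (((words d).filter P).card : K)

open Classical in
theorem coeff_wordSeries (P : List ℕ → Prop) (d : ℕ →₀ ℕ) :
    MvPowerSeries.coeff d (wordSeries K P) = (((words d).filter P).card : K) := rfl

theorem wordSeries_congr {P Q : List ℕ → Prop} (h : ∀ l, P l ↔ Q l) :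
    wordSeries K P = wordSeries K Q := by
  congr 1
  funext l
  exact propext (h l)

theorem wordSeries_add {P P₁ P₂ : List ℕ → Prop} (h : ∀ l, P l ↔ P₁ l ∨ P₂ l)
    (hd : ∀ l, P₁ l → ¬ P₂ l) : wordSeries K P = wordSeries K P₁ + wordSeries K P₂ := by
  classical
  ext d
  rw [map_add, coeff_wordSeries, coeff_wordSeries, coeff_wordSeries, ← Nat.cast_add,
    ← Finset.card_union_of_disjoint, ← Finset.filter_or]
  · congr 2
    exact Finset.filter_congr fun l _ => h l
  · rw [Finset.disjoint_filter]
    exact fun l _ => hd l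

theorem wordSeries_eq_zero {P : List ℕ → Prop} (h : ∀ l, ¬ P l) : wordSeries K P = 0 := by
  classical
  ext d
  rw [coeff_wordSeries, Finset.filter_false_of_mem fun l _ => h l]
  simp

/-- The fixed length of the first factor makes the cutting point of a concatenation unique. -/
theorem wordSeries_mul {P Q : List ℕ → Prop} {a : ℕ} (hP : ∀ l, P l → l.length = a) :
    wordSeries K P * wordSeries K Q =
      wordSeries K fun l => P (l.take a) ∧ Q (l.drop a) := by
  classical
  ext d
  rw [MvPowerSeries.coeff_mul, coeff_wordSeries,
    Finset.card_eq_sum_card_fiberwise (t := Finset.HasAntidiagonal.antidiagonal d)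
      (f := fun l : List ℕ => (((l.take a : List ℕ) : Multiset ℕ).toFinsupp,
        ((l.drop a : List ℕ) : Multiset ℕ).toFinsupp)), Nat.cast_sum]
  · refine Finset.sum_congr rfl fun p hp => ?_
    rw [Finset.HasAntidiagonal.mem_antidiagonal] at hp
    rw [coeff_wordSeries, coeff_wordSeries, ← Nat.cast_mul, ← Finset.card_product]
    congr 1
    refine Finset.card_nbij' (fun q => q.1 ++ q.2) (fun l => (l.take a, l.drop a)) ?_ ?_ ?_ ?_
    · rintro ⟨u, v⟩ h
      simp only [Finset.coe_product, Finset.coe_filter, Set.mem_prod, Set.mem_ofPred_eq,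
        mem_words] at h
      have hu := hP u h.1.2
      simp only [Finset.coe_filter, Finset.mem_filter, Set.mem_ofPred_eq, mem_words,
        List.take_left' hu, List.drop_left' hu]
      refine ⟨⟨?_, h.1.2, h.2.2⟩, Prod.ext h.1.1 h.2.1⟩
      rw [← Multiset.coe_add, Multiset.toFinsupp_add, h.1.1, h.2.1, hp]
    · intro l h
      simp only [Finset.coe_filter, Finset.mem_filter, Set.mem_ofPred_eq] at h
      simp only [Finset.coe_product, Finset.coe_filter, Set.mem_prod, Set.mem_ofPred_eq,
        mem_words]
      obtain ⟨h1, h2⟩ := h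
      rw [Prod.ext_iff] at h2
      exact ⟨⟨h2.1, h1.2.1⟩, h2.2, h1.2.2⟩
    · rintro ⟨u, v⟩ h
      simp only [Finset.coe_product, Finset.coe_filter, Set.mem_prod, Set.mem_ofPred_eq] at h
      have hu := hP u h.1.2
      simp only [List.take_left' hu, List.drop_left' hu]
    · intro l _
      exact List.take_append_drop a l
  · intro l hl
    simp only [Finset.coe_filter, Set.mem_ofPred_eq, mem_words] at hl
    rw [Finset.mem_coe, Finset.HasAntidiagonal.mem_antidiagonal, ← Multiset.toFinsupp_add,
      Multiset.coe_add, List.take_append_drop, hl.1]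

/-- `a r b ¬r c r ⋯` for the letters `a, b, c, …` of a word. -/
def IsAltWord (r : ℕ → ℕ → Prop) : List ℕ → Prop
  | [] => True
  | a :: l => (∀ b ∈ l.head?, r a b) ∧ IsAltWord (fun x y => ¬ r x y) l

theorem isAltWord_cons_cons {r : ℕ → ℕ → Prop} {a b : ℕ} {l : List ℕ} :
    IsAltWord r (a :: b :: l) ↔ r a b ∧ (∀ c ∈ l.head?, ¬ r b c) ∧ IsAltWord r l := by
  simp [IsAltWord]

variable (K) in
/-- The generating function of the `r`-chains of length `n`. -/
noncomputable def chainSeries (r : ℕ → ℕ → Prop) (n : ℕ) : MvPowerSeries ℕ K :=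
  wordSeries K fun l => l.length = n ∧ l.IsChain r

variable (K) in
/-- The generating function of the alternating words of length `n`. -/
noncomputable def altSeries (r : ℕ → ℕ → Prop) (n : ℕ) : MvPowerSeries ℕ K :=
  wordSeries K fun l => l.length = n ∧ IsAltWord r l

/-- An `r`-chain of length `a`, followed by a word with property `P`, without relation `r` at the
junction. -/
def IsJoin (r : ℕ → ℕ → Prop) (P : List ℕ → Prop) (n a : ℕ) (l : List ℕ) : Prop :=
  l.length = n ∧ (l.take a).IsChain r ∧ P (l.drop a) ∧
    ∀ x ∈ (l.take a).getLast?, ∀ y ∈ (l.drop a).head?, ¬ r x y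

theorem chainSeries_mul (r : ℕ → ℕ → Prop) (P : List ℕ → Prop) {n a : ℕ} (ha : a ≤ n) :
    chainSeries K r a * wordSeries K (fun l => l.length = n - a ∧ P l) =
      wordSeries K fun l => l.length = n ∧ (l.take a).IsChain r ∧ P (l.drop a) := by
  rw [chainSeries, wordSeries_mul fun l h => h.1]
  refine wordSeries_congr fun l => ?_
  rw [List.length_take, List.length_drop]
  constructor
  · rintro ⟨⟨h1, h2⟩, h3, h4⟩
    exact ⟨by omega, h2, h4⟩
  · rintro ⟨h1, h2, h3⟩
    exact ⟨⟨by omega, h2⟩, by omega, h3⟩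

theorem exists_take_drop {l : List ℕ} {a : ℕ} (ha : 0 < a) (hal : a < l.length) :
    ∃ u x y v, l = u ++ x :: y :: v ∧ l.take a = u ++ [x] ∧ l.drop a = y :: v ∧
      u.length + 1 = a := by
  have h1 : l.take a ≠ [] := by
    intro h
    have := congrArg List.length h
    rw [List.length_take, List.length_nil] at this
    omega
  obtain ⟨u, x, hu⟩ : ∃ u x, l.take a = u ++ [x] :=
    ⟨_, _, (List.dropLast_append_getLast h1).symm⟩
  have h2 : l.drop a ≠ [] := by simpa using hal
  obtain ⟨y, v, hv⟩ := List.exists_cons_of_ne_nil h2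
  refine ⟨u, x, y, v, ?_, hu, hv, ?_⟩
  · rw [← List.take_append_drop a l, hu, hv]
    simp
  · have := congrArg List.length hu
    simp at this
    omega

section Alternating

variable (K) (r : ℕ → ℕ → Prop)

/-- The auxiliary series of the telescoping argument for alternating words. -/
noncomputable def joinAltSeries (n a : ℕ) : MvPowerSeries ℕ K :=
  if a = 0 then 0 else if a ≤ n then wordSeries K (IsJoin r (IsAltWord r) n a)
  else if a = n + 1 then chainSeries K r n else 0

theorem chainSeries_zero : chainSeries K r 0 = 1 := by
  classical
  ext d
  rw [chainSeries, coeff_wordSeries, MvPowerSeries.coeff_one]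
  trans ((if d = 0 then {[]} else ∅ : Finset (List ℕ)).card : K)
  · congr 2
    ext l
    refine (@Finset.mem_filter _ _ (_) _ _).trans ?_
    rw [mem_words]
    constructor
    · rintro ⟨h1, h2, -⟩
      obtain rfl := List.length_eq_zero_iff.1 h2
      have : d = 0 := by rw [← h1]; simp
      simp [this]
    · split_ifs with hd
      · intro h
        obtain rfl := Finset.mem_singleton.1 h
        simp [hd]
      · simp
  · split_ifs <;> simp

theorem altSeries_zero : altSeries K r 0 = 1 := by
  rw [← chainSeries_zero K r]
  refine wordSeries_congr fun l => and_congr_right fun h => ?_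
  obtain rfl := List.length_eq_zero_iff.1 h
  simp [IsAltWord]

/-- Split by the junction of chain and alternating word. If `r` fails there, the pair is counted by
the first summand. If it holds, the chain absorbs the next two letters, and `r` fails at the new
junction because the word alternates. For `a = n - 1` only one letter is left to absorb, which
explains the value of `joinAltSeries` at `n + 1`. -/
theorem chainSeries_mul_altSeries {n a : ℕ} (hn : 0 < n) (ha : a ≤ n) :
    chainSeries K r a * altSeries K r (n - a) =
      joinAltSeries K r n a + joinAltSeries K r n (a + 2) := by
  have hjoin2 : ∀ (u v : List ℕ) (b c : ℕ), u.length = a →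
      (IsJoin r (IsAltWord r) (u ++ b :: c :: v).length (a + 2) (u ++ b :: c :: v) ↔
        (u.IsChain r ∧ ∀ x ∈ u.getLast?, r x b) ∧ IsAltWord r (b :: c :: v)) := by
    intro u v b c hu
    have h1 : u ++ b :: c :: v = (u ++ [b, c]) ++ v := by simp
    have h2 : (u ++ [b, c]).length = a + 2 := by simp [hu]
    rw [IsJoin, h1, List.take_left' h2, List.drop_left' h2, List.isChain_append,
      isAltWord_cons_cons]
    simp
    tauto
  rcases Nat.eq_zero_or_pos a with rfl | ha0
  · rw [chainSeries_zero, one_mul, Nat.sub_zero]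
    have h0 : joinAltSeries K r n 0 = 0 := if_pos rfl
    rw [h0, zero_add, joinAltSeries, if_neg (by omega)]
    split_ifs with h2 h3
    · refine wordSeries_congr fun l => ?_
      match l with
      | [] => simp [IsJoin]
      | [b] => simp [IsJoin]; omega
      | b :: c :: v =>
        have := hjoin2 [] v b c rfl
        simp only [List.nil_append, zero_add] at this
        constructor
        · rintro ⟨rfl, h⟩
          rw [this]
          simpa using h
        · intro h
          have hn := h.1
          subst hn
          rw [this] at h
          exact ⟨rfl, h.2⟩
    · obtain rfl : n = 1 := by omega
      refine wordSeries_congr fun l => and_congr_right fun h => ?_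
      obtain ⟨b, rfl⟩ := List.length_eq_one_iff.1 h
      simp [IsAltWord]
    · omega
  · rw [altSeries, chainSeries_mul r _ ha]
    have h1 : joinAltSeries K r n a = wordSeries K (IsJoin r (IsAltWord r) n a) := by
      rw [joinAltSeries, if_neg ha0.ne', if_pos ha]
    rw [h1]
    refine (wordSeries_add (P₁ := IsJoin r (IsAltWord r) n a)
      (P₂ := fun l => l.length = n ∧ ((l.take a).IsChain r ∧
      IsAltWord r (l.drop a) ∧ ¬ ∀ x ∈ (l.take a).getLast?, ∀ y ∈ (l.drop a).head?, ¬ r x y))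
      (fun l => ?_) fun l h1 h2 => h2.2.2.2 h1.2.2.2).trans ?_
    · rw [IsJoin]
      tauto
    · congr 1
      rw [joinAltSeries, if_neg (by omega)]
      rcases ha.lt_or_eq with han | rfl
      · rcases Nat.lt_or_ge n (a + 2) with han2 | han2
        · rw [if_neg (by omega), if_pos (by omega)]
          refine wordSeries_congr fun l => and_congr_right fun hl => ?_
          obtain ⟨u, x, y, v, hl', hu, hv, hlen⟩ := exists_take_drop ha0 (hl.symm ▸ han)
          have : v = [] := by
            rw [← List.length_eq_zero_iff]
            have := congrArg List.length hl'
            simp at this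
            omega
          subst this
          have : u ++ [x, y] = (u ++ [x]) ++ [y] := by simp
          rw [hu, hv, hl', this, List.isChain_append]
          simp [IsAltWord, List.isChain_append]
          tauto
        · rw [if_pos han2]
          refine wordSeries_congr fun l => ?_
          by_cases hl : l.length = n
          · obtain ⟨u, x, y, v, hl', hu, hv, hlen⟩ := exists_take_drop ha0 (hl.symm ▸ han)
            obtain ⟨z, w, rfl⟩ : ∃ z w, v = z :: w := by
              apply List.exists_cons_of_ne_nil
              rintro rfl
              have := congrArg List.length hl'
              simp at this
              omega
            have h3 := hjoin2 (u ++ [x]) w y z (by simpa using hlen)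
            have : u ++ x :: y :: z :: w = u ++ [x] ++ y :: z :: w := by simp
            rw [hu, hv, ← hl, hl', this, h3]
            simp
            tauto
          · simp [IsJoin, hl]
      -- For `a = n` the second word is empty, so the junction condition cannot fail.
      · rw [if_neg (by omega), if_neg (by omega)]
        refine wordSeries_eq_zero fun l h => h.2.2.2 ?_
        simp [List.drop_of_length_le h.1.le]

/-- With signs `(-1)^(a/2)` on even `a`, the sums supplied by `chainSeries_mul_altSeries` telescope.
For `n > 0` the surviving top term is the sine coefficient if `n` is odd, and zero if `n` is even.
-/
theorem cosSeries_mul_altSeries :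
    cosSeries (chainSeries K r) * PowerSeries.mk (altSeries K r) =
      1 + sinSeries (chainSeries K r) := by
  ext n : 1
  rw [PowerSeries.coeff_mul, Finset.Nat.sum_antidiagonal_eq_sum_range_succ_mk, map_add,
    PowerSeries.coeff_one]
  rcases Nat.eq_zero_or_pos n with rfl | hn
  · simp [cosSeries, sinSeries, chainSeries_zero, altSeries_zero]
  · let c : ℕ → MvPowerSeries ℕ K := fun a => if Even a then (-1) ^ (a / 2) else 0
    have hc : ∀ a, c (a + 2) = -c a := by
      intro a
      simp only [c, Nat.even_add, even_two, iff_true]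
      split_ifs
      · rw [Nat.add_div_right _ two_pos, pow_succ, mul_neg_one]
      · simp
    have h1 : ∀ a ∈ Finset.range n.succ,
        PowerSeries.coeff (a, n - a).1 (cosSeries (chainSeries K r)) *
          PowerSeries.coeff (a, n - a).2 (PowerSeries.mk (altSeries K r)) =
        c a * joinAltSeries K r n a - c (a + 2) * joinAltSeries K r n (a + 2) := by
      intro a ha
      rw [Finset.mem_range] at ha
      rw [cosSeries, PowerSeries.coeff_mk, PowerSeries.coeff_mk, hc, neg_mul, sub_neg_eq_add,
        ← mul_add, ← chainSeries_mul_altSeries K r hn (by omega), ← mul_assoc]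
      congr 1
      simp only [c]
      split_ifs <;> simp
    -- Telescoping in steps of two leaves two boundary terms at each end.
    have h2 : ∀ (w : ℕ → MvPowerSeries ℕ K) (m : ℕ), ∑ a ∈ Finset.range m, (w a - w (a + 2)) =
        w 0 + w 1 - w m - w (m + 1) := by
      intro w m
      induction m with
      | zero => simp
      | succ m ih =>
        rw [Finset.sum_range_succ, ih]
        abel
    rw [Finset.sum_congr rfl h1, h2 fun a => c a * joinAltSeries K r n a]
    have e0 : joinAltSeries K r n 0 = 0 := if_pos rfl
    have e1 : c 1 = 0 := by simp [c]
    have e2 : joinAltSeries K r n (n.succ + 1) = 0 := by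
      rw [joinAltSeries, if_neg (by omega), if_neg (by omega), if_neg (by omega)]
    have e3 : joinAltSeries K r n n.succ = chainSeries K r n := by
      rw [joinAltSeries, if_neg (by omega), if_neg (by omega), if_pos rfl]
    rw [e0, e1, e2, e3, if_neg hn.ne', sinSeries, PowerSeries.coeff_mk]
    rcases Nat.even_or_odd' n with ⟨j, rfl | rfl⟩
    · simp [c]
    · have h3 : c (2 * j + 1).succ = -(-1) ^ j := by
        simp only [c]
        rw [if_pos ⟨j + 1, by omega⟩, show (2 * j + 1).succ / 2 = j + 1 by omega, pow_succ]
        ring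
      rw [h3, if_neg (by simp), show (2 * j + 1) / 2 = j by omega]
      ring

/-- The auxiliary series of the telescoping argument for pairs of chains. -/
noncomputable def joinChainSeries (n a : ℕ) : MvPowerSeries ℕ K :=
  if a = 0 then 0 else if a ≤ n then
    wordSeries K (IsJoin r (List.IsChain fun x y => ¬ r x y) n a) else 0

/-- If `r` holds at the junction, one letter moves into the first chain, and `r` fails at the new
junction since the second word is a chain for the negation. -/
theorem chainSeries_mul_chainSeries {n a : ℕ} (hn : 0 < n) (ha : a ≤ n) :
    chainSeries K r a * chainSeries K (fun x y => ¬ r x y) (n - a) =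
      joinChainSeries K r n a + joinChainSeries K r n (a + 1) := by
  have hjoin1 : ∀ (u v : List ℕ) (b : ℕ), u.length = a →
      (IsJoin r (List.IsChain fun x y => ¬ r x y) (u ++ b :: v).length (a + 1) (u ++ b :: v) ↔
        (u.IsChain r ∧ ∀ x ∈ u.getLast?, r x b) ∧ (b :: v).IsChain fun x y => ¬ r x y) := by
    intro u v b hu
    have h1 : u ++ b :: v = (u ++ [b]) ++ v := by simp
    have h2 : (u ++ [b]).length = a + 1 := by simp [hu]
    rw [IsJoin, h1, List.take_left' h2, List.drop_left' h2, List.isChain_append,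
      List.isChain_cons (x := b) (l := v)]
    simp
    tauto
  rcases Nat.eq_zero_or_pos a with rfl | ha0
  · rw [chainSeries_zero, one_mul, Nat.sub_zero]
    have h0 : joinChainSeries K r n 0 = 0 := if_pos rfl
    rw [h0, zero_add, joinChainSeries, if_neg (by omega), if_pos (by omega)]
    refine wordSeries_congr fun l => ?_
    match l with
    | [] => simp [IsJoin]
    | b :: v =>
      have := hjoin1 [] v b rfl
      simp only [List.nil_append, zero_add] at this
      constructor
      · rintro ⟨rfl, h⟩
        rw [this]
        simpa using h
      · intro h
        have hn := h.1
        subst hn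
        rw [this] at h
        exact ⟨rfl, h.2⟩
  · rw [chainSeries.eq_1 K fun x y => ¬ r x y, chainSeries_mul r _ ha]
    have h1 : joinChainSeries K r n a =
        wordSeries K (IsJoin r (List.IsChain fun x y => ¬ r x y) n a) := by
      rw [joinChainSeries, if_neg ha0.ne', if_pos ha]
    rw [h1]
    refine (wordSeries_add (P₁ := IsJoin r (List.IsChain fun x y => ¬ r x y) n a)
      (P₂ := fun l => l.length = n ∧ ((l.take a).IsChain r ∧
      ((l.drop a).IsChain fun x y => ¬ r x y) ∧
        ¬ ∀ x ∈ (l.take a).getLast?, ∀ y ∈ (l.drop a).head?, ¬ r x y))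
      (fun l => ?_) fun l h1 h2 => h2.2.2.2 h1.2.2.2).trans ?_
    · rw [IsJoin]
      tauto
    · congr 1
      rw [joinChainSeries, if_neg (by omega)]
      rcases ha.lt_or_eq with han | rfl
      · rw [if_pos (by omega)]
        refine wordSeries_congr fun l => ?_
        by_cases hl : l.length = n
        · obtain ⟨u, x, y, v, hl', hu, hv, hlen⟩ := exists_take_drop ha0 (hl.symm ▸ han)
          have h3 := hjoin1 (u ++ [x]) v y (by simpa using hlen)
          have : u ++ x :: y :: v = u ++ [x] ++ y :: v := by simp
          rw [hu, hv, ← hl, hl', this, h3]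
          simp
          tauto
        · simp [IsJoin, hl]
      · rw [if_neg (by omega)]
        refine wordSeries_eq_zero fun l h => h.2.2.2 ?_
        simp [List.drop_of_length_le h.1.le]

/-- For `r` the relation `>`, this is `∑ (-1)^a e_a h_{n-a} = 0`. -/
theorem sum_neg_one_pow_chainSeries_mul {n : ℕ} (hn : 0 < n) :
    ∑ a ∈ Finset.range (n + 1),
      (-1) ^ a * (chainSeries K r a * chainSeries K (fun x y => ¬ r x y) (n - a)) = 0 := by
  have h1 : ∀ a ∈ Finset.range (n + 1),
      (-1) ^ a * (chainSeries K r a * chainSeries K (fun x y => ¬ r x y) (n - a)) =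
      (-1) ^ a * joinChainSeries K r n a - (-1) ^ (a + 1) * joinChainSeries K r n (a + 1) := by
    intro a ha
    rw [Finset.mem_range] at ha
    rw [chainSeries_mul_chainSeries K r hn (by omega)]
    ring
  rw [Finset.sum_congr rfl h1,
    Finset.sum_range_sub' (fun a => (-1) ^ a * joinChainSeries K r n a)]
  simp [joinChainSeries]

end Alternating

/-- There is exactly one way to arrange given letters as a chain. -/
theorem chainSeries_eq_completeSymm (r : ℕ → ℕ → Prop) [IsTrans ℕ r] [Std.Antisymm r]
    [Std.Total r] (n : ℕ) : chainSeries K r n = completeSymm K n := by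
  classical
  ext d
  rw [chainSeries, coeff_wordSeries, coeff_completeSymm]
  have : Trans r r r := ⟨fun h1 h2 => IsTrans.trans _ _ _ h1 h2⟩
  have hcard : ∀ l : List ℕ, l ∈ words d → l.length = d.degree := by
    intro l hl
    rw [mem_words, Multiset.toFinsupp_eq_iff] at hl
    rw [← Multiset.coe_card, hl, Finsupp.card_toMultiset]
    rfl
  trans ((if d.degree = n then {(Finsupp.toMultiset d).sort r} else ∅ : Finset (List ℕ)).card : K)
  · congr 2
    ext l
    refine (@Finset.mem_filter _ _ (_) _ _).trans ?_
    split_ifs with hd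
    · rw [Finset.mem_singleton]
      constructor
      · rintro ⟨h1, -, h3⟩
        rw [List.isChain_iff_pairwise] at h3
        refine List.Perm.eq_of_pairwise' (r := r) h3 (Multiset.pairwise_sort _ _) ?_
        rw [mem_words, Multiset.toFinsupp_eq_iff] at h1
        rw [← Multiset.coe_eq_coe, h1, Multiset.sort_eq]
      · rintro rfl
        have h1 : (Finsupp.toMultiset d).sort r ∈ words d := by
          rw [mem_words, Multiset.sort_eq, Multiset.toFinsupp_eq_iff]
        refine ⟨h1, (hcard _ h1).trans hd, ?_⟩
        rw [List.isChain_iff_pairwise]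
        exact Multiset.pairwise_sort _ _
    · simp only [Finset.notMem_empty, iff_false]
      rintro ⟨h1, h2, -⟩
      exact hd ((hcard l h1).symm.trans h2)
  · split_ifs <;> simp

theorem evalH_hGen_eq_chainSeries (n : ℕ) :
    evalH K (hGen K n) = chainSeries K (fun x y => x ≥ y) n := by
  have : IsTrans ℕ fun x y => x ≥ y := ⟨fun _ _ _ h1 h2 => le_trans h2 h1⟩
  have : Std.Antisymm fun x y : ℕ => x ≥ y := ⟨fun _ _ h1 h2 => le_antisymm h2 h1⟩
  have : Std.Total fun x y : ℕ => x ≥ y := ⟨fun a b => le_total b a⟩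
  rw [evalH_hGen, chainSeries_eq_completeSymm]

/-- Both generating series are inverse to that of `(-1)^n h_n`, and inverses are unique. The `h_n`
appear here as chains for `≤`, the negation of `>`. -/
theorem evalH_eGen_eq_chainSeries (n : ℕ) :
    evalH K (eGen K n) = chainSeries K (fun x y => x > y) n := by
  have hle : (fun x y : ℕ => ¬ x > y) = fun x y => x ≤ y := by
    funext x y
    rw [not_lt]
  have hh : ∀ n, chainSeries K (fun x y : ℕ => ¬ x > y) n = evalH K (hGen K n) := by
    intro n
    have : IsTrans ℕ fun x y => x ≤ y := ⟨fun _ _ _ h1 h2 => le_trans h1 h2⟩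
    have : Std.Antisymm fun x y : ℕ => x ≤ y := ⟨fun _ _ h1 h2 => le_antisymm h1 h2⟩
    have : Std.Total fun x y : ℕ => x ≤ y := ⟨fun a b => le_total a b⟩
    rw [hle, evalH_hGen, chainSeries_eq_completeSymm]
  have h1 := congrArg (PowerSeries.map (evalH K : MvPolynomial ℕ K →+* MvPowerSeries ℕ K))
    (hSeriesNeg_mul_eSeries (K := K))
  rw [map_mul, map_one] at h1
  have h2 : PowerSeries.mk (chainSeries K fun x y => x > y) *
      PowerSeries.map (evalH K : MvPolynomial ℕ K →+* MvPowerSeries ℕ K) (hSeriesNeg K) = 1 := by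
    ext n : 1
    rw [PowerSeries.coeff_mul, Finset.Nat.sum_antidiagonal_eq_sum_range_succ_mk,
      PowerSeries.coeff_one]
    rcases Nat.eq_zero_or_pos n with rfl | hn
    · simp [hSeriesNeg, chainSeries_zero, hGen]
    · rw [if_neg hn.ne', ← mul_zero ((-1) ^ n), ← sum_neg_one_pow_chainSeries_mul K (fun x y => x > y) hn,
        Finset.mul_sum]
      refine Finset.sum_congr rfl fun a ha => ?_
      rw [Finset.mem_range] at ha
      rw [PowerSeries.coeff_mk, PowerSeries.coeff_map, hSeriesNeg, PowerSeries.coeff_mk, map_mul,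
        map_pow, map_neg, map_one, hh, RingHom.coe_coe]
      obtain ⟨b, rfl⟩ := Nat.exists_eq_add_of_le (show a ≤ n by omega)
      rw [Nat.add_sub_cancel_left, pow_add]
      rcases neg_one_pow_eq_or (MvPowerSeries ℕ K) a with h | h <;> simp [h] <;> ring
  have h3 : PowerSeries.mk (chainSeries K fun x y => x > y) =
      PowerSeries.map (evalH K : MvPolynomial ℕ K →+* MvPowerSeries ℕ K) (eSeries K) := by
    linear_combination PowerSeries.map (evalH K : MvPolynomial ℕ K →+* MvPowerSeries ℕ K)
      (eSeries K) * h2 - PowerSeries.mk (chainSeries K fun x y => x > y) * h1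
  have h4 := congrArg (PowerSeries.coeff n) h3
  rw [PowerSeries.coeff_mk, PowerSeries.coeff_map] at h4
  exact h4.symm

end Words

end SymFun

namespace SymFun

/-! ### Border strips as alternating words, and Euler numbers. -/

section AlternatingStrips

variable {K : Type*} [Field K]

theorem coeff_wordSeries_eq_card (P : List ℕ → Prop) (d : ℕ →₀ ℕ) :
    MvPowerSeries.coeff d (wordSeries K P) = (Nat.card {l // l ∈ words d ∧ P l} : K) := by
  classical
  rw [coeff_wordSeries, ← Nat.card_eq_finsetCard]
  congr 1
  exact Nat.card_congr (Equiv.subtypeEquivRight fun l => Finset.mem_filter)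

theorem isAltWord_iff_getElem {r : ℕ → ℕ → Prop} {l : List ℕ} :
    IsAltWord r l ↔ ∀ (i : ℕ) (h : i + 1 < l.length),
      if Even i then r l[i] l[i + 1] else ¬ r l[i] l[i + 1] := by
  induction l generalizing r with
  | nil => simp [IsAltWord]
  | cons a l ih =>
    rw [IsAltWord, ih]
    constructor
    · rintro ⟨h1, h2⟩ i hi
      cases i with
      | zero =>
        rw [if_pos (by simp)]
        simp only [List.length_cons] at hi
        apply h1
        simp [List.head?_eq_getElem?, List.getElem?_eq_getElem (show 0 < l.length by omega)]
      | succ i =>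
        simp only [List.length_cons] at hi
        have := h2 i (by omega)
        simp only [Nat.even_add_one, List.getElem_cons_succ]
        by_cases hi : Even i <;> simpa [hi] using this
    · intro h
      constructor
      · intro b hb
        have hl : 0 < l.length := by
          rw [List.length_pos_iff]
          rintro rfl
          simp at hb
        have := h 0 (by simpa using hl)
        rw [List.head?_eq_getElem?, List.getElem?_eq_getElem hl] at hb
        simp at this hb
        rwa [hb] at this
      · intro i hi
        have := h (i + 1) (by simp; omega)
        simp only [Nat.even_add_one, List.getElem_cons_succ] at this
        by_cases hi : Even i <;> simpa [hi] using this

theorem toFinsupp_ofFn {n : ℕ} (w : Fin n → ℕ) :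
    ((List.ofFn w : List ℕ) : Multiset ℕ).toFinsupp = ∑ i, Finsupp.single (w i) 1 := by
  have (l : List ℕ) : (l : Multiset ℕ).toFinsupp = (l.map fun a => Finsupp.single a 1).sum := by
    induction l with
    | nil => simp
    | cons a l ih =>
      rw [← Multiset.cons_coe, ← Multiset.singleton_add, Multiset.toFinsupp_add, ih,
        Multiset.toFinsupp_singleton, List.map_cons, List.sum_cons]
  rw [this, List.map_ofFn, List.sum_ofFn]
  rfl

theorem isAltWord_ofFn {r : ℕ → ℕ → Prop} {n : ℕ} (w : Fin n → ℕ) :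
    IsAltWord r (List.ofFn w) ↔ ∀ (i : ℕ) (h : i + 1 < n),
      if Even i then r (w ⟨i, by omega⟩) (w ⟨i + 1, h⟩)
      else ¬ r (w ⟨i, by omega⟩) (w ⟨i + 1, h⟩) := by
  rw [isAltWord_iff_getElem]
  simp only [List.length_ofFn, List.getElem_ofFn]

/-- A skew Schur function of a shape whose cells can be listed so that semistandardness is the
alternating condition. -/
theorem skewSchur_eq_altSeries {D : Finset (ℕ × ℕ)} {n : ℕ} {e : ℕ → ℕ × ℕ}
    (hmem : ∀ c, c ∈ D ↔ ∃ i < n, e i = c)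
    (hinj : ∀ i j, i < n → j < n → e i = e j → i = j) (r : ℕ → ℕ → Prop)
    (hss : ∀ (T : D → ℕ) (w : ℕ → ℕ), (∀ (c : D) (i : ℕ), i < n → e i = c.1 → T c = w i) →
      (IsSemistandard D T ↔
        ∀ i, i + 1 < n → if Even i then r (w i) (w (i + 1)) else ¬ r (w i) (w (i + 1)))) :
    skewSchur K D = altSeries K r n := by
  classical
  let E : Fin n ≃ D := Equiv.ofBijective (fun i => ⟨e i, (hmem _).2 ⟨i, i.2, rfl⟩⟩)
    ⟨fun i j h => Fin.ext (hinj i j i.2 j.2 (Subtype.ext_iff.1 h)), fun c => by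
      obtain ⟨i, hi, h⟩ := (hmem c.1).1 c.2
      exact ⟨⟨i, hi⟩, Subtype.ext h⟩⟩
  have hE' : ∀ (c : D) (i : ℕ) (hi : i < n), e i = c.1 → E ⟨i, hi⟩ = c := fun c i hi h =>
    Subtype.ext h
  ext d
  rw [altSeries, coeff_wordSeries_eq_card]
  show (Nat.card {T : D → ℕ // IsSemistandard D T ∧ ∑ c, Finsupp.single (T c) 1 = d} : K) = _
  congr 1
  have hprop : ∀ T : D → ℕ, (IsSemistandard D T ∧ ∑ c, Finsupp.single (T c) 1 = d) ↔
      (List.ofFn fun i => T (E i)) ∈ words d ∧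
        (List.ofFn fun i => T (E i)).length = n ∧ IsAltWord r (List.ofFn fun i => T (E i)) := by
    intro T
    -- `hss` wants a sequence on all of `ℕ`; the value `0` from index `n` on is never read.
    rw [mem_words, toFinsupp_ofFn, E.sum_comp fun c => Finsupp.single (T c) 1, isAltWord_ofFn,
      hss T (fun i => if h : i < n then T (E ⟨i, h⟩) else 0)]
    · rw [and_comm]
      refine and_congr_right fun _ => ?_
      simp only [List.length_ofFn, true_and]
      refine forall_congr' fun i => forall_congr' fun hi => ?_
      rw [dif_pos (by omega), dif_pos hi]
    · intro c i hi h
      rw [dif_pos hi, hE' c i hi h]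
  refine Nat.card_eq_of_bijective
    (fun T => ⟨List.ofFn fun i => T.1 (E i), (hprop T.1).1 T.2⟩) ⟨fun T T' h => ?_, fun l => ?_⟩
  · have h1 := List.ofFn_injective (Subtype.ext_iff.1 h)
    refine Subtype.ext (funext fun c => ?_)
    obtain ⟨i, rfl⟩ := E.surjective c
    exact congrFun h1 i
  · obtain ⟨l, hl⟩ := l
    have hlen : l.length = n := hl.2.1
    subst hlen
    have h1 : (List.ofFn fun i => (fun c => l.get (E.symm c)) (E i)) = l := by
      simp
    refine ⟨⟨fun c => l.get (E.symm c), (hprop _).2 ?_⟩, Subtype.ext h1⟩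
    rw [h1]
    exact hl

/-- The words counted use each of `0, …, n - 1` once. Without repeated letters `>` and `≥` give the
same count, so one hypothesis on `r` serves both. -/
theorem coeff_altSeries_eq_eulerNumber {r : ℕ → ℕ → Prop} (hr : ∀ x y, x ≠ y → (r x y ↔ y < x))
    (n : ℕ) :
    MvPowerSeries.coeff (∑ i ∈ Finset.range n, Finsupp.single i 1) (altSeries K r n) =
      (eulerNumber n : K) := by
  classical
  rw [altSeries, coeff_wordSeries_eq_card, eulerNumber]
  congr 1
  symm
  have hprop : ∀ w : Equiv.Perm (Fin n), IsAlternatingPerm w ↔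
      (List.ofFn fun i => (w i : ℕ)) ∈ words (∑ i ∈ Finset.range n, Finsupp.single i 1) ∧
        (List.ofFn fun i => (w i : ℕ)).length = n ∧
          IsAltWord r (List.ofFn fun i => (w i : ℕ)) := by
    intro w
    rw [mem_words, toFinsupp_ofFn, Equiv.sum_comp w fun j : Fin n => Finsupp.single (j : ℕ) 1,
      isAltWord_ofFn, Fin.sum_univ_eq_sum_range fun j => Finsupp.single j 1]
    simp only [List.length_ofFn, true_and]
    constructor
    · intro h i hi
      have h1 := h ⟨i, by omega⟩ ⟨i + 1, hi⟩ rfl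
      have hne : (w ⟨i, by omega⟩ : ℕ) ≠ w ⟨i + 1, hi⟩ := fun h =>
        by simpa using w.injective (Fin.ext h)
      rw [hr _ _ hne]
      simp only at h1
      split_ifs at h1 ⊢
      · exact h1
      · exact not_lt.2 (le_of_lt h1)
    · rintro h ⟨i, hi⟩ ⟨j, hj⟩ hij
      simp only at hij
      subst hij
      have h1 := h i hj
      have hne : (w ⟨i, hi⟩ : ℕ) ≠ w ⟨i + 1, hj⟩ := fun h =>
        by simpa using w.injective (Fin.ext h)
      rw [hr _ _ hne] at h1
      simp only
      split_ifs at h1 ⊢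
      · exact h1
      · exact lt_of_le_of_ne (not_lt.1 h1) fun h => hne (congrArg _ h)
  refine Nat.card_eq_of_bijective
    (fun w => ⟨List.ofFn fun i => (w.1 i : ℕ), (hprop w.1).1 w.2⟩) ⟨fun w w' h => ?_, fun l => ?_⟩
  · have h1 := List.ofFn_injective (Subtype.ext_iff.1 h)
    refine Subtype.ext (Equiv.ext fun i => Fin.ext ?_)
    exact congrFun h1 i
  · obtain ⟨l, hl⟩ := l
    obtain ⟨hw, hlen, -⟩ := id hl
    rw [mem_words, Multiset.toFinsupp_eq_iff, Finsupp.toMultiset_sum_single, one_smul] at hw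
    subst hlen
    have hlt : ∀ i : Fin l.length, l.get i < l.length := fun i => by
      have : l.get i ∈ (l : Multiset ℕ) := l.get_mem i
      rw [hw] at this
      simpa using this
    have hnd : l.Nodup := by
      rw [← Multiset.coe_nodup, hw]
      exact Finset.nodup _
    have hinj : Function.Injective fun i : Fin l.length => (⟨l.get i, hlt i⟩ : Fin l.length) :=
      fun i j h => hnd.injective_get (Fin.ext_iff.1 h)
    let w : Equiv.Perm (Fin l.length) := Equiv.ofBijective _ (Finite.injective_iff_bijective.1 hinj)
    have h1 : (List.ofFn fun i => (w i : ℕ)) = l := List.ofFn_get l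
    refine ⟨⟨w, (hprop w).2 ?_⟩, Subtype.ext h1⟩
    rw [h1]
    exact hl

theorem length_tauComposition {n : ℕ} (hn : n ≠ 0) : (tauComposition n).length = n / 2 + 1 := by
  rw [Composition.length, tauComposition]
  simp only [if_neg hn]
  split_ifs with h
  · rw [Nat.even_iff] at h
    simp
    omega
  · rw [Nat.even_iff] at h
    simp
    omega

theorem sizeUpTo_tauComposition {n t : ℕ} (ht : t ≤ (n - 1) / 2) :
    (tauComposition n).sizeUpTo (t + 1) = if n = 0 then 0 else 2 * t + 1 := by
  rw [Composition.sizeUpTo, tauComposition]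
  simp only
  split_ifs with h0
  · simp
  · rw [List.take_succ_cons, List.sum_cons, List.take_append_of_le_length (by simpa using ht),
      List.take_replicate, List.sum_replicate, min_eq_left ht]
    simp
    omega
  · rw [List.take_succ_cons, List.sum_cons, List.take_append_of_le_length (by simpa using ht),
      List.take_replicate, List.sum_replicate, min_eq_left ht]
    simp
    omega

theorem sizeUpTo_tauComposition_eq {n t : ℕ} (ht : t < (tauComposition n).length) :
    (tauComposition n).sizeUpTo t = 2 * t - 1 := by
  have hn : n ≠ 0 := by
    rintro rfl
    simp [tauComposition, Composition.length] at ht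
  rw [length_tauComposition hn] at ht
  cases t with
  | zero => simp
  | succ t =>
    rw [sizeUpTo_tauComposition (by omega), if_neg hn]
    omega

/-- Truncated subtraction accounts for the first row of length `1`; the minimum with `n` shortens
the last row when `n` is even. -/
theorem blocksFun_tauComposition {n : ℕ} (t : Fin (tauComposition n).length) :
    (tauComposition n).blocksFun t = min (2 * (t : ℕ) + 1) n - (2 * (t : ℕ) - 1) := by
  have hn : n ≠ 0 := by
    rintro rfl
    have := t.2
    simp [tauComposition, Composition.length] at this
  have h1 := (tauComposition n).sizeUpTo_succ' t
  have ht := t.2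
  rw [sizeUpTo_tauComposition_eq ht] at h1
  have h2 := length_tauComposition hn
  rcases Nat.lt_or_ge (t + 1 : ℕ) (tauComposition n).length with h | h
  · rw [sizeUpTo_tauComposition_eq h] at h1
    omega
  · rw [(tauComposition n).sizeUpTo_ofLength_le _ h] at h1
    omega

/-- The index `i` counts cells along the strip from its bottom left end, the steps going alternately
up and right. -/
theorem mem_tau {n : ℕ} {c : ℕ × ℕ} :
    c ∈ tau n ↔ ∃ i < n, (n / 2 - (i + 1) / 2, i / 2) = c := by
  rw [tau, borderStrip, Finset.mem_biUnion]
  constructor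
  · rintro ⟨t, -, hc⟩
    obtain ⟨j, hj, rfl⟩ := Finset.mem_image.1 hc
    have hn : n ≠ 0 := by
      rintro rfl
      have := t.2
      simp [tauComposition, Composition.length] at this
    rw [Finset.mem_range, blocksFun_tauComposition] at hj
    have ht := t.2
    rw [sizeUpTo_tauComposition_eq ht]
    have hlen := length_tauComposition hn
    refine ⟨2 * t - 1 + j, by omega, Prod.ext ?_ ?_⟩ <;> simp only <;> omega
  · rintro ⟨i, hi, rfl⟩
    have hn : n ≠ 0 := by omega
    have hlen := length_tauComposition hn
    refine ⟨⟨(i + 1) / 2, by omega⟩, Finset.mem_univ _, Finset.mem_image.2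
      ⟨i - (2 * ((i + 1) / 2) - 1), ?_, ?_⟩⟩
    · rw [Finset.mem_range, blocksFun_tauComposition]
      simp only
      omega
    · rw [sizeUpTo_tauComposition_eq (by simp only; omega)]
      refine Prod.ext ?_ ?_ <;> simp only <;> omega

/-- A step up is a strict descent and a step right a weak ascent. No row or column has more than two
cells, so comparing neighbours suffices. -/
theorem skewSchur_tau (n : ℕ) : skewSchur K (tau n) = altSeries K (fun x y => x > y) n := by
  refine skewSchur_eq_altSeries (e := fun i => (n / 2 - (i + 1) / 2, i / 2)) (fun c => mem_tau)
    (fun i j hi hj h => ?_) _ fun T w hw => ?_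
  · simp only [Prod.mk.injEq] at h
    omega
  · constructor
    · rintro ⟨h1, h2⟩ i hi
      have m1 : (n / 2 - (i + 1) / 2, i / 2) ∈ tau n := mem_tau.2 ⟨i, by omega, rfl⟩
      have m2 : (n / 2 - (i + 1 + 1) / 2, (i + 1) / 2) ∈ tau n := mem_tau.2 ⟨i + 1, hi, rfl⟩
      rw [← hw ⟨_, m1⟩ i (by omega) rfl, ← hw ⟨_, m2⟩ (i + 1) hi rfl]
      split_ifs with hev
      · rw [Nat.even_iff] at hev
        exact h2 _ _ (by simp only; omega) (by simp only; omega)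
      · rw [Nat.even_iff] at hev
        exact not_lt.2 (h1 _ _ (by simp only; omega) (by simp only; omega))
    · intro h
      refine ⟨?_, ?_⟩
      · rintro ⟨c, hc⟩ ⟨c', hc'⟩ h3 h4
        obtain ⟨i, hi, rfl⟩ := mem_tau.1 hc
        obtain ⟨j, hj, rfl⟩ := mem_tau.1 hc'
        simp only at h3 h4
        obtain rfl : j = i + 1 := by omega
        rw [hw _ i hi rfl, hw _ (i + 1) hj rfl]
        have := h i hj
        rw [if_neg (by rw [Nat.even_iff]; omega)] at this
        exact not_lt.1 this
      · rintro ⟨c, hc⟩ ⟨c', hc'⟩ h3 h4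
        obtain ⟨i, hi, rfl⟩ := mem_tau.1 hc
        obtain ⟨j, hj, rfl⟩ := mem_tau.1 hc'
        simp only at h3 h4
        obtain rfl : i = j + 1 := by omega
        rw [hw _ (j + 1) hi rfl, hw _ j hj rfl]
        have := h j hi
        rwa [if_pos (by rw [Nat.even_iff]; omega)] at this

theorem mem_conjugate_tau {n : ℕ} {c : ℕ × ℕ} :
    c ∈ conjugate (tau n) ↔ ∃ i < n, (i / 2, n / 2 - (i + 1) / 2) = c := by
  rw [conjugate, Finset.mem_image]
  constructor
  · rintro ⟨c, hc, rfl⟩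
    obtain ⟨i, hi, rfl⟩ := mem_tau.1 hc
    exact ⟨i, hi, rfl⟩
  · rintro ⟨i, hi, rfl⟩
    exact ⟨_, mem_tau.2 ⟨i, hi, rfl⟩, rfl⟩

/-- After transposition the steps go left and down, so the weak and strict relations change places.
-/
theorem skewSchur_conjugate_tau (n : ℕ) :
    skewSchur K (conjugate (tau n)) = altSeries K (fun x y => x ≥ y) n := by
  refine skewSchur_eq_altSeries (e := fun i => (i / 2, n / 2 - (i + 1) / 2))
    (fun c => mem_conjugate_tau) (fun i j hi hj h => ?_) _ fun T w hw => ?_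
  · simp only [Prod.mk.injEq] at h
    omega
  · constructor
    · rintro ⟨h1, h2⟩ i hi
      have m1 : (i / 2, n / 2 - (i + 1) / 2) ∈ conjugate (tau n) :=
        mem_conjugate_tau.2 ⟨i, by omega, rfl⟩
      have m2 : ((i + 1) / 2, n / 2 - (i + 1 + 1) / 2) ∈ conjugate (tau n) :=
        mem_conjugate_tau.2 ⟨i + 1, hi, rfl⟩
      rw [← hw ⟨_, m1⟩ i (by omega) rfl, ← hw ⟨_, m2⟩ (i + 1) hi rfl]
      split_ifs with hev
      · rw [Nat.even_iff] at hev
        exact h1 _ _ (by simp only; omega) (by simp only; omega)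
      · rw [Nat.even_iff] at hev
        exact not_le.2 (h2 _ _ (by simp only; omega) (by simp only; omega))
    · intro h
      refine ⟨?_, ?_⟩
      · rintro ⟨c, hc⟩ ⟨c', hc'⟩ h3 h4
        obtain ⟨i, hi, rfl⟩ := mem_conjugate_tau.1 hc
        obtain ⟨j, hj, rfl⟩ := mem_conjugate_tau.1 hc'
        simp only at h3 h4
        obtain rfl : i = j + 1 := by omega
        rw [hw _ (j + 1) hi rfl, hw _ j hj rfl]
        have := h j hi
        rwa [if_pos (by rw [Nat.even_iff]; omega)] at this
      · rintro ⟨c, hc⟩ ⟨c', hc'⟩ h3 h4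
        obtain ⟨i, hi, rfl⟩ := mem_conjugate_tau.1 hc
        obtain ⟨j, hj, rfl⟩ := mem_conjugate_tau.1 hc'
        simp only at h3 h4
        obtain rfl : j = i + 1 := by omega
        rw [hw _ i hi rfl, hw _ (i + 1) hj rfl]
        have := h i hj
        rw [if_neg (by rw [Nat.even_iff]; omega)] at this
        exact not_le.1 this

/-- Reversing the listing, `i ↦ n - 1 - i`, exchanges the cells of the two shapes. -/
theorem conjugate_tau_of_odd {n : ℕ} (hn : Odd n) : conjugate (tau n) = tau n := by
  ext c
  rw [mem_conjugate_tau, mem_tau]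
  obtain ⟨m, rfl⟩ := hn
  constructor
  · rintro ⟨i, hi, rfl⟩
    refine ⟨2 * m - i, by omega, Prod.ext ?_ ?_⟩ <;> simp only <;> omega
  · rintro ⟨i, hi, rfl⟩
    refine ⟨2 * m - i, by omega, Prod.ext ?_ ?_⟩ <;> simp only <;> omega

end AlternatingStrips

end SymFun

open Polynomial SymFun in
theorem mainTheorem1 {K : Type*} [Field K] [CharZero K] (n : ℕ) (f : MvPowerSeries ℕ K)
    (hf : IsHomogeneousSymmetric n f) :
    (Odd n →
      hallInner n f (skewSchur K (tau n)) = hallInner n f (skewSchur K (conjugate (tau n))) ∧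
      hallInner n f (skewSchur K (conjugate (tau n))) =
        umbral (powerSumSubst n f (periodicFour (X : K[X]) 0 (-X) 0))) ∧
    (Even n →
      hallInner n f (skewSchur K (tau n)) =
        umbral (powerSumSubst n f (periodicFour (X : K[X]) (-1) (-X) 1)) ∧
      hallInner n f (skewSchur K (conjugate (tau n))) =
        umbral (powerSumSubst n f (periodicFour (X : K[X]) 1 (-X) (-1)))) := by
  have hcoeff : ∀ r : ℕ → ℕ → Prop, PowerSeries.coeff n (PowerSeries.mk (altSeries K r)) =
      altSeries K r n := fun r => PowerSeries.coeff_mk _ _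
  have hge : ∀ m, MvPowerSeries.coeff (∑ i ∈ Finset.range m, Finsupp.single i 1)
      (PowerSeries.coeff m (PowerSeries.mk (altSeries K fun x y => x ≥ y))) =
        (eulerNumber m : K) := fun m => by
    rw [PowerSeries.coeff_mk]
    exact coeff_altSeries_eq_eulerNumber (fun x y h => by omega) m
  have hgt : ∀ m, MvPowerSeries.coeff (∑ i ∈ Finset.range m, Finsupp.single i 1)
      (PowerSeries.coeff m (PowerSeries.mk (altSeries K fun x y => x > y))) =
        (eulerNumber m : K) := fun m => by
    rw [PowerSeries.coeff_mk]
    exact coeff_altSeries_eq_eulerNumber (fun x y h => by omega) m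
  have hH : cosSeries (fun n => evalH K (hGen K n)) *
      PowerSeries.mk (altSeries K fun x y => x ≥ y) =
        1 + sinSeries fun n => evalH K (hGen K n) := by
    simp only [evalH_hGen_eq_chainSeries]
    exact cosSeries_mul_altSeries K _
  have hEl : cosSeries (fun n => evalH K (eGen K n)) *
      PowerSeries.mk (altSeries K fun x y => x > y) =
        1 + sinSeries fun n => evalH K (eGen K n) := by
    simp only [evalH_eGen_eq_chainSeries]
    exact cosSeries_mul_altSeries K _
  -- For odd `n` the shape is self-conjugate and the tangent of the `h_n` suffices. For even `n`,
  -- `τ_n` belongs to the `e_n` with `c = -1`, and its conjugate to the `h_n` with `c = 1`.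
  refine ⟨fun hn => ⟨by rw [conjugate_tau_of_odd hn], ?_⟩, fun hn => ⟨?_, ?_⟩⟩
  · rw [skewSchur_conjugate_tau, ← hcoeff, hallInner_tan (Nat.not_even_iff_odd.2 hn) hf rfl
      hGen_mem_hSpan skewD_hGen' hH hge]
    simp
  · rw [skewSchur_tau, ← hcoeff, hallInner_sec hn hf eGen_zero eGen_mem_hSpan skewD_eGen hEl hgt]
    simp
  · rw [skewSchur_conjugate_tau, ← hcoeff, hallInner_sec hn hf rfl hGen_mem_hSpan skewD_hGen'
      hH hge]
    simp
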